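/- Fix $\lambda\in[0,1]$. Let $\sqrt z$ be the analytic square root on $\mathbb C\setminus[0,\infty)$ with $\sqrt{-1}=i$ and let $w^{1/2}$ be the principal square root. For $\alpha\in(0,\pi)$, $\beta>0$ let $\Delta_{\alpha,\beta}$ be the set of $z\neq0$ with $|\arg z-\pi|<\alpha$ ($\arg z\in[0,2\pi)$) and $|z|<\beta$; a property holds \emph{near zero} if for every $\alpha\in(0,\pi)$ it holds on $\Delta_{\alpha,\beta}$ for some $\beta>0$. For a symmetric probability measure $\mu$ on $\mathbb R$ put $G_\mu(z)=\int\frac{d\mu(x)}{z-x}$ and $$H_\mu(z)=\lambda\,G_\mu\!\left(\tfrac1{\sqrt z}\right)^2+(1-\lambda)\sqrt z\,G_\mu\!\left(\tfrac1{\sqrt z}\right),$$ and let $H_\mu^{-1}$ be its compositional inverse near zero (analytic near zero, with $H_\mu^{-1}(z)/z\to1$ as $z\to0$ in each sector $\Delta_{\alpha,1}$). The rectangular $R$-transform is $C_\mu(z)=U\!\left(z/H_\mu^{-1}(z)-1\right)$ near zero, where $U(z)=\frac{-\lambda-1+[(\lambda+1)^2+4\lambda z]^{1/2}}{2\lambda}$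 if $\lambda>0$ and $U(z)=z$ if $\lambda=0$. The rectangular free convolution $\mu\boxplus_\lambda\nu$ is the symmetric probability measure with $C_{\mu\boxplus_\lambda\nu}=C_\mu+C_\nu$ near zero, and $\nu$ is $\boxplus_\lambda$-infinitely divisible if for every $n\ge1$ it is the $n$-th $\boxplus_\lambda$-power of a symmetric probability measure. A symmetric finite positive measure $G$ on $\mathbb R$ is the Lévy measure of a symmetric classically infinitely divisible law $\mu$ if $$\int e^{ix\xi}\,d\mu(x)=\exp\!\left(\int(\cos(x\xi)-1)\frac{1+x^2}{x^2}\,dG(x)\right)\quad(\xi\in\mathbb R)$$ (the integrand being $-\xi^2/2$ at $x=0$), and it is the Lévy measure of a $\boxplus_\lambda$-infinitely divisible law $\nu$ if $C_\nu(z)=z\int\frac{1+x^2}{1-zx^2}\,dG(x)$ near zero. The rectangular Bercovici--Pata bijection $\Lambda_\lambda$ maps a symmetric classically infinitely divisible law $\mu$ to the unique $\boxplus_\lambda$-infinitely divisible law with the same Lévy measure. \textbf{Proposition.} Let $\lambda\in[0,1]$ and $t>0$, and let $\mathcal C_t=\frac1\pi\frac{t\,dx}{t^2+x^2}$ be the symmetric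 Cauchy law with parameter $t$. Then $\Lambda_\lambda(\mathcal C_t)$ is well defined and equals $$1_{\mathbb R\setminus\left[-\frac{t(1-\lambda)}2,\frac{t(1-\lambda)}2\right]}(x)\;\frac{t}{\pi(\lambda t^2+x^2)}\left[1-\frac{t^2(1-\lambda)^2}{4x^2}\right]^{1/2}dx .$$ Its support is $\mathbb R\setminus\left(-\frac{t(1-\lambda)}2,\frac{t(1-\lambda)}2\right)$. It is a Cauchy law (i.e. of the form $\frac1\pi\frac{s\,dx}{s^2+(x-x_0)^2}$ with $x_0\in\mathbb R$, $s>0$) if and only if $\lambda=1$. -/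

import Mathlib

open MeasureTheory ProbabilityTheory Filter Topology Set

noncomputable section

namespace RectFree

/-- Symmetric probability measures on the real line. -/
structure IsSymmProb (μ : Measure ℝ) : Prop where
  isProb : IsProbabilityMeasure μ
  symm : μ.map (fun x => -x) = μ

/-- Finite positive symmetric measures on the real line. -/
structure IsSymmFinite (G : Measure ℝ) : Prop where
  isFinite : IsFiniteMeasure G
  symm : G.map (fun x => -x) = G

/-! ### Classical infinite divisibility -/

/-- The `n`-th classical convolution power of a measure. -/
def convPow (μ : Measure ℝ) : ℕ → Measure ℝ
  | 0 => Measure.dirac 0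
  | n + 1 => (convPow μ n).conv μ

/-- Classical infinite divisibility. -/
def IsInfDiv (μ : Measure ℝ) : Prop :=
  ∀ n : ℕ, 1 ≤ n → ∃ ρ : Measure ℝ, IsProbabilityMeasure ρ ∧ convPow ρ n = μ

/-- The integrand `(cos (x ξ) - 1) (1 + x ^ 2) / x ^ 2` of the symmetric Lévy-Khinchine formula,
continuously extended by `-ξ ^ 2 / 2` at `x = 0`. -/
def levyKernel (ξ x : ℝ) : ℝ :=
  if x = 0 then -ξ ^ 2 / 2 else (Real.cos (x * ξ) - 1) * ((1 + x ^ 2) / x ^ 2)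

/-- `G` is the (symmetric, finite) Lévy measure of the symmetric measure `μ`. -/
def IsClassicalLevy (μ G : Measure ℝ) : Prop :=
  IsSymmFinite G ∧
    ∀ ξ : ℝ, charFun μ ξ = Complex.exp ((∫ x, levyKernel ξ x ∂G : ℝ) : ℂ)

/-! ### The rectangular R-transform with ratio `lam` -/

/-- The branch of the square root on the complement of `[0, ∞)` with value `i` at `-1`. -/
def rsqrt (z : ℂ) : ℂ := Complex.I * (-z) ^ (1 / 2 : ℂ)

/-- The Cauchy transform. -/
def cauchyG (μ : Measure ℝ) (z : ℂ) : ℂ := ∫ x : ℝ, 1 / (z - (x : ℂ)) ∂μ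

/-- The function `H_μ`. -/
def rectH (lam : ℝ) (μ : Measure ℝ) (z : ℂ) : ℂ :=
  lam * cauchyG μ (1 / rsqrt z) ^ 2 + (1 - lam) * rsqrt z * cauchyG μ (1 / rsqrt z)

/-- The function `U`; `U z = z` if `lam = 0`. -/
def rectU (lam : ℝ) (z : ℂ) : ℂ :=
  if lam = 0 then z
  else (-lam - 1 + (((lam : ℂ) + 1) ^ 2 + 4 * lam * z) ^ (1 / 2 : ℂ)) / (2 * lam)

/-- The sector `Δ_{α,β}` of nonzero complex `z` with `|arg z - π| < α` (for the argument with
values in `[0, 2π)`) and `|z| < β`; note that `|arg z - π|` is `|Complex.arg (-z)|`. -/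
def sector (α β : ℝ) : Set ℂ :=
  {z | z ≠ 0 ∧ |Complex.arg (-z)| < α ∧ ‖z‖ < β}

/-- `P` holds near `0` off the half line `[0, ∞)`: for every `α` in `(0, π)` it holds on
`Δ_{α,β}` for some `β > 0`. -/
def NearZero (P : ℂ → Prop) : Prop :=
  ∀ α ∈ Ioo 0 Real.pi, ∃ β > 0, ∀ z ∈ sector α β, P z

/-- `F` is a version of the compositional inverse of `H_μ` near `0` off the half line `[0, ∞)`. -/
structure IsRectInverse (lam : ℝ) (μ : Measure ℝ) (F : ℂ → ℂ) : Prop where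
  analytic : ∀ α ∈ Ioo 0 Real.pi, ∃ β > 0, DifferentiableOn ℂ F (sector α β)
  tendsto : ∀ α ∈ Ioo 0 Real.pi, Tendsto (fun z => F z / z) (𝓝[sector α 1] 0) (𝓝 1)
  right_inv : NearZero fun z => rectH lam μ (F z) = z
  left_inv : NearZero fun z => F (rectH lam μ z) = z

/-- `C` agrees, near `0` off the half line `[0, ∞)`, with the rectangular R-transform
`C_μ(z) = U (z / H_μ⁻¹(z) - 1)`. -/
def IsRectRTransform (lam : ℝ) (μ : Measure ℝ) (C : ℂ → ℂ) : Prop :=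
  ∃ F : ℂ → ℂ, IsRectInverse lam μ F ∧ NearZero fun z => C z = rectU lam (z / F z - 1)

/-! ### Rectangular free convolution, infinite divisibility, and Lévy measures -/

/-- `ρ` is the rectangular free convolution of `μ` and `ν`: the symmetric probability measure
whose rectangular R-transform is the sum of those of `μ` and `ν`. -/
def IsRectConv (lam : ℝ) (μ ν ρ : Measure ℝ) : Prop :=
  IsSymmProb μ ∧ IsSymmProb ν ∧ IsSymmProb ρ ∧
    ∃ C D : ℂ → ℂ, IsRectRTransform lam μ C ∧ IsRectRTransform lam ν D ∧
      IsRectRTransform lam ρ (fun z => C z + D z)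

/-- `ρ` is the `n`-th rectangular free convolution power of `μ`. -/
def IsRectConvPow (lam : ℝ) (μ : Measure ℝ) : ℕ → Measure ℝ → Prop
  | 0, ρ => ρ = Measure.dirac 0
  | 1, ρ => ρ = μ
  | n + 2, ρ => ∃ σ : Measure ℝ, IsRectConvPow lam μ (n + 1) σ ∧ IsRectConv lam σ μ ρ

/-- Infinite divisibility for the rectangular free convolution with ratio `lam`. -/
def IsRectInfDiv (lam : ℝ) (ν : Measure ℝ) : Prop :=
  IsSymmProb ν ∧
    ∀ n : ℕ, 1 ≤ n → ∃ ρ : Measure ℝ, IsSymmProb ρ ∧ IsRectConvPow lam ρ n ν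

/-- `G` is the Lévy measure of `ν` for the rectangular free convolution with ratio `lam`. -/
def IsRectLevy (lam : ℝ) (ν G : Measure ℝ) : Prop :=
  IsSymmFinite G ∧
    IsRectRTransform lam ν
      (fun z => z * ∫ x : ℝ, (1 + (x : ℂ) ^ 2) / (1 - z * (x : ℂ) ^ 2) ∂G)

/-! ### The rectangular Bercovici-Pata bijection -/

/-- `μ` is a symmetric classically infinitely divisible law, and `ν` is an infinitely divisible
law for the rectangular free convolution with ratio `lam` that has the same Lévy measure. -/
def IsRectBPImage (lam : ℝ) (μ ν : Measure ℝ) : Prop :=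
  IsSymmProb μ ∧ IsInfDiv μ ∧ IsRectInfDiv lam ν ∧
    ∃ G : Measure ℝ, IsClassicalLevy μ G ∧ IsRectLevy lam ν G

open Classical in
/-- The rectangular Bercovici-Pata bijection: the unique `ν` with `IsRectBPImage lam μ ν`
(and the zero measure, which is never such a `ν`, if there is no unique one). -/
def rectBP (lam : ℝ) (μ : Measure ℝ) : Measure ℝ :=
  if h : ∃! ν, IsRectBPImage lam μ ν then h.choose else 0

/-- The symmetric Cauchy law with parameter `t > 0`. -/
def cauchyLaw (t : ℝ) : Measure ℝ := cauchyMeasure 0 t.toNNReal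

/-- The density of the rectangular Cauchy law. -/
def rectCauchyDensity (lam t x : ℝ) : ℝ :=
  (Icc (-(t * (1 - lam) / 2)) (t * (1 - lam) / 2))ᶜ.indicator
    (fun y => t / (Real.pi * (lam * t ^ 2 + y ^ 2)) *
      Real.sqrt (1 - t ^ 2 * (1 - lam) ^ 2 / (4 * y ^ 2))) x

end RectFree

end

/-!
The image of the Cauchy law under the rectangular Bercovici-Pata bijection is computed from its
R-transform, and identified by two uniqueness statements.

Write `c = t (1 - lam) / 2` and `e = t (1 + lam) / 2`, so that `c + e = t` and `e - c = lam t`.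

*The Lévy measure.* Fourier inversion for the two-sided exponential gives the characteristic
function `exp (-t |ξ|)` of the Cauchy law (`charFun_cauchyLaw`), hence its infinite divisibility,
and, after a dominated limit, `∫ (1 - cos (x ξ)) / x ^ 2 = π |ξ|`. So the Lévy measure is `t` times
the standard Cauchy law (`isClassicalLevy_cauchyLaw`). It is the only one, because the second
difference in `ξ` of the Lévy kernel is `2 cos (x ξ)` times a weight, and the weights for the
steps `1` and `√2` have no common zero (`IsClassicalLevy.unique`). For `z` off `[0, ∞)` the
corresponding R-transform is `-t √(-z)` (`levyTransform_cauchyLevy`).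

*The R-transform of the explicit density.* The substitution `x = √(y ^ 2 + c ^ 2)` turns the
density into the rational function `(t / π) y ^ 2 / ((y ^ 2 + c ^ 2) (y ^ 2 + e ^ 2))`
(`integral_rectCauchy_sq`). Its Stieltjes transform is elementary: with `k ^ 2 = c ^ 2 + ζ ^ 2` and
`Re k > 0`, the integral of `1 / (ζ ^ 2 + x ^ 2)` is `1 / ((k + e) (k + c))`. This collapses `H` to
`-1 / ζ ^ 2 ↦ -1 / (k + e) ^ 2` (`rectH_rectCauchy`), a map whose inverse
`z / ((1 - t √(-z)) (1 - lam t √(-z)))` is read off by solving for `ζ`. Applying `U` gives the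
R-transform `-t √(-z)` (`isRectRTransform_rectCauchy`). It is linear in `t`, so the laws form a
convolution semigroup, and infinite divisibility follows.

*Uniqueness.* A symmetric law is determined by its R-transform (`IsRectRTransform.unique`). The
R-transform determines `H⁻¹`, hence `H` on the negative half-line near zero, where `H` is a
strictly monotone function of `∫ 1 / (u + x ^ 2)`. Knowing this integral for large `u` gives, by
differentiation in `u`, all moments of the bounded variable `1 / (u + x ^ 2)`, hence its law, hence
the symmetric law of `x`.

The density vanishes on `[-c, c]` and is positive elsewhere, which gives the support. A Cauchy law
charges every interval, so it can occur only if `c = 0`, that is `lam = 1`.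
-/

noncomputable section

namespace RectFree

open scoped FourierTransform

/-! ### The symmetric Cauchy law -/

lemma cauchyLaw_eq_withDensity {t : ℝ} (ht : 0 < t) :
    cauchyLaw t = volume.withDensity
      (fun x => ENNReal.ofReal (t / (Real.pi * (t ^ 2 + x ^ 2)))) := by
  rw [cauchyLaw, cauchyMeasure_of_scale_ne_zero _ (by simpa using ht)]
  congr 1
  ext x
  rw [cauchyPDF_def, cauchyPDFReal_def, Real.coe_toNNReal _ ht.le]
  congr 1
  have := Real.pi_pos
  field_simp
  ring

instance isProbabilityMeasure_cauchyLaw (t : ℝ) : IsProbabilityMeasure (cauchyLaw t) := by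
  unfold cauchyLaw; infer_instance

lemma integral_cauchyLaw {E : Type*} [NormedAddCommGroup E] [NormedSpace ℝ E] {t : ℝ}
    (ht : 0 < t) (f : ℝ → E) :
    ∫ x, f x ∂(cauchyLaw t) = ∫ x, (t / (Real.pi * (t ^ 2 + x ^ 2))) • f x := by
  rw [cauchyLaw_eq_withDensity ht,
    integral_withDensity_eq_integral_toReal_smul (by fun_prop) (by simp)]
  congr 1
  ext x
  rw [ENNReal.toReal_ofReal]
  have := Real.pi_pos
  positivity

/-- A measure with an even density is symmetric. -/
lemma map_neg_withDensity {f : ℝ → ENNReal} (hf : ∀ x, f (-x) = f x) :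
    (volume.withDensity f).map (fun x => -x) = volume.withDensity f := by
  have e : (fun x : ℝ => -x) = (MeasurableEquiv.neg ℝ) := rfl
  ext s hs
  rw [e, MeasurableEquiv.map_apply, withDensity_apply _ hs,
    withDensity_apply _ ((MeasurableEquiv.neg ℝ).measurable hs),
    ← (Measure.measurePreserving_neg (volume : Measure ℝ)).setLIntegral_comp_preimage_emb
      (MeasurableEquiv.neg ℝ).measurableEmbedding f s]
  simp [hf]

lemma isSymmProb_cauchyLaw {t : ℝ} (ht : 0 < t) : IsSymmProb (cauchyLaw t) where
  isProb := inferInstance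
  symm := by
    rw [cauchyLaw_eq_withDensity ht]
    exact map_neg_withDensity fun x => by simp

lemma integrable_inv_sq_add_sq {b : ℝ} (hb : 0 < b) :
    Integrable fun x : ℝ => 1 / (b ^ 2 + x ^ 2) := by
  have := (integrable_cauchyPDFReal 0 (γ := b.toNNReal)).const_mul (Real.pi / b)
  refine this.congr (ae_of_all _ fun x => ?_)
  simp only [cauchyPDFReal_def, Real.coe_toNNReal _ hb.le]
  have := Real.pi_pos
  field_simp
  ring

/-! ### Cauchy kernels with a complex parameter -/

section

variable {k : ℂ}

lemma add_mul_I_ne_zero (hk : 0 < k.re) (w : ℝ) : k + w * Complex.I ≠ 0 := fun h => by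
  have := congrArg Complex.re h
  simp at this
  linarith

lemma sub_mul_I_ne_zero (hk : 0 < k.re) (w : ℝ) : k - w * Complex.I ≠ 0 := fun h => by
  have := congrArg Complex.re h
  simp at this
  linarith

lemma sq_add_sq_eq_mul (k : ℂ) (w : ℝ) :
    k ^ 2 + (w : ℂ) ^ 2 = (k + w * Complex.I) * (k - w * Complex.I) := by
  ring_nf
  simp

lemma sq_add_sq_ne_zero (hk : 0 < k.re) (w : ℝ) : k ^ 2 + (w : ℂ) ^ 2 ≠ 0 := by
  rw [sq_add_sq_eq_mul]
  exact mul_ne_zero (add_mul_I_ne_zero hk w) (sub_mul_I_ne_zero hk w)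

lemma continuous_inv_sq_add_sq (hk : 0 < k.re) :
    Continuous fun w : ℝ => 1 / (k ^ 2 + (w : ℂ) ^ 2) :=
  Continuous.div (by fun_prop) (by fun_prop) (sq_add_sq_ne_zero hk)

lemma integrable_complex_inv_sq_add_sq (hk : 0 < k.re) :
    Integrable fun w : ℝ => 1 / (k ^ 2 + (w : ℂ) ^ 2) := by
  have h := integrable_inv_sq_add_sq hk
  have hb := ((h.comp_add_right k.im).add (h.comp_sub_right k.im)).const_mul (1 / 2)
  refine hb.mono' (continuous_inv_sq_add_sq hk).aestronglyMeasurable (ae_of_all _ fun w => ?_)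
  have e1 : ‖k + w * Complex.I‖ ^ 2 = k.re ^ 2 + (w + k.im) ^ 2 := by
    rw [Complex.sq_norm, Complex.normSq_apply]; simp; ring
  have e2 : ‖k - w * Complex.I‖ ^ 2 = k.re ^ 2 + (w - k.im) ^ 2 := by
    rw [Complex.sq_norm, Complex.normSq_apply]; simp; ring
  simp only [Pi.add_apply]
  rw [← e1, ← e2, sq_add_sq_eq_mul, norm_div, norm_mul, norm_one]
  -- the arithmetic-geometric mean inequality for the two linear factors
  have := two_mul_le_add_sq (1 / ‖k + w * Complex.I‖) (1 / ‖k - w * Complex.I‖)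
  rw [div_pow, div_pow, one_pow] at this
  calc _ = 1 / 2 * (2 * (1 / ‖k + w * Complex.I‖) * (1 / ‖k - w * Complex.I‖)) := by
        rw [mul_assoc, one_div_mul_one_div]; ring
    _ ≤ _ := by gcongr

lemma exp_neg_mul_abs_eqOn_Ioi :
    EqOn (fun v : ℝ => Complex.exp (-(2 * Real.pi * k) * v))
      (fun v : ℝ => Complex.exp (-(2 * Real.pi * k) * |v|)) (Ioi 0) := fun v hv => by
  simp [abs_of_pos (mem_Ioi.1 hv)]

lemma exp_neg_mul_abs_eqOn_Iic :
    EqOn (fun v : ℝ => Complex.exp (2 * Real.pi * k * v))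
      (fun v : ℝ => Complex.exp (-(2 * Real.pi * k) * |v|)) (Iic 0) := fun v hv => by
  simp [abs_of_nonpos (mem_Iic.1 hv)]

lemma integrable_exp_neg_mul_abs (hk : 0 < k.re) :
    Integrable fun v : ℝ => Complex.exp (-(2 * Real.pi * k) * |v|) := by
  have hpi := Real.pi_pos
  have hk' : 0 < (2 * Real.pi * k).re := by simp; positivity
  rw [← integrableOn_univ, ← Iic_union_Ioi (a := (0 : ℝ))]
  refine IntegrableOn.union ?_ ?_
  · exact (integrableOn_exp_mul_complex_Iic hk' 0).congr_fun exp_neg_mul_abs_eqOn_Iic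
      measurableSet_Iic
  · exact (integrableOn_exp_mul_complex_Ioi (by simpa using hk') 0).congr_fun
      exp_neg_mul_abs_eqOn_Ioi measurableSet_Ioi

/-- The Fourier transform of the two-sided exponential is a Cauchy kernel. -/
lemma fourier_exp_neg_mul_abs (hk : 0 < k.re) (w : ℝ) :
    𝓕 (fun v : ℝ => Complex.exp (-(2 * Real.pi * k) * |v|)) w =
      k / Real.pi * (1 / (k ^ 2 + (w : ℂ) ^ 2)) := by
  have hpi := Real.pi_pos
  rw [Real.fourier_real_eq_integral_exp_smul]
  have hint : Integrable fun v : ℝ => Complex.exp (↑(-2 * Real.pi * v * w) * Complex.I) •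
      Complex.exp (-(2 * Real.pi * k) * |v|) := by
    refine (integrable_exp_neg_mul_abs hk).bdd_mul (c := 1) (by fun_prop)
      (ae_of_all _ fun v => ?_)
    rw [Complex.norm_exp_ofReal_mul_I]
  rw [← setIntegral_univ, ← Iic_union_Ioi (a := (0 : ℝ)),
    setIntegral_union (Iic_disjoint_Ioi le_rfl) measurableSet_Ioi hint.integrableOn
      hint.integrableOn]
  have h1 : ∫ v in Iic (0 : ℝ), Complex.exp (↑(-2 * Real.pi * v * w) * Complex.I) •
      Complex.exp (-(2 * Real.pi * k) * |v|) =
      ∫ v in Iic (0 : ℝ), Complex.exp ((2 * Real.pi * (k - w * Complex.I)) * v) := by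
    refine setIntegral_congr_fun measurableSet_Iic fun v hv => ?_
    simp only [← exp_neg_mul_abs_eqOn_Iic hv, smul_eq_mul, ← Complex.exp_add]
    congr 1
    push_cast
    ring
  have h2 : ∫ v in Ioi (0 : ℝ), Complex.exp (↑(-2 * Real.pi * v * w) * Complex.I) •
      Complex.exp (-(2 * Real.pi * k) * |v|) =
      ∫ v in Ioi (0 : ℝ), Complex.exp ((-(2 * Real.pi * (k + w * Complex.I))) * v) := by
    refine setIntegral_congr_fun measurableSet_Ioi fun v hv => ?_
    simp only [← exp_neg_mul_abs_eqOn_Ioi hv, smul_eq_mul, ← Complex.exp_add]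
    congr 1
    push_cast
    ring
  rw [h1, h2, integral_exp_mul_complex_Iic (by simp; positivity),
    integral_exp_mul_complex_Ioi (by simp; positivity)]
  have hp := add_mul_I_ne_zero hk w
  have hm := sub_mul_I_ne_zero hk w
  have hpi' : (Real.pi : ℂ) ≠ 0 := by exact_mod_cast hpi.ne'
  rw [sq_add_sq_eq_mul]
  simp only [mul_zero, Complex.ofReal_zero, Complex.exp_zero]
  field_simp
  ring

/-- Fourier inversion for the two-sided exponential. -/
lemma integral_exp_mul_inv_sq_add_sq (hk : 0 < k.re) (v : ℝ) :
    ∫ w : ℝ, Complex.exp ((2 * Real.pi * w * v : ℝ) * Complex.I) *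
      (k / Real.pi * (1 / (k ^ 2 + (w : ℂ) ^ 2))) = Complex.exp (-(2 * Real.pi * k) * |v|) := by
  have hF := funext (fourier_exp_neg_mul_abs hk)
  have hinv := congrFun (Continuous.fourierInv_fourier_eq
    (f := fun v : ℝ => Complex.exp (-(2 * Real.pi * k) * |v|)) (by fun_prop)
    (integrable_exp_neg_mul_abs hk)
    (by rw [hF]; exact (integrable_complex_inv_sq_add_sq hk).const_mul _)) v
  rw [hF, Real.fourierInv_eq'] at hinv
  rw [← hinv]
  congr 1
  ext w
  rw [smul_eq_mul]
  congr 4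
  simp
  ring

lemma integral_complex_inv_sq_add_sq (hk : 0 < k.re) :
    ∫ w : ℝ, 1 / (k ^ 2 + (w : ℂ) ^ 2) = Real.pi / k := by
  have h := integral_exp_mul_inv_sq_add_sq hk 0
  have hk0 : k ≠ 0 := fun h => by simp [h] at hk
  have hpi' : (Real.pi : ℂ) ≠ 0 := by exact_mod_cast Real.pi_ne_zero
  simp only [mul_zero, Complex.ofReal_zero, zero_mul, Complex.exp_zero, one_mul, abs_zero] at h
  rw [integral_const_mul] at h
  rw [eq_div_iff hk0]
  field_simp at h
  linear_combination h

end

/-! ### Classical infinite divisibility of the Cauchy law -/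

lemma charFun_cauchyLaw {t : ℝ} (ht : 0 < t) (ξ : ℝ) :
    charFun (cauchyLaw t) ξ = Complex.exp ((-(t * |ξ|) : ℝ) : ℂ) := by
  have hpi := Real.pi_pos
  have hpi' : (Real.pi : ℂ) ≠ 0 := by exact_mod_cast hpi.ne'
  have h := integral_exp_mul_inv_sq_add_sq (k := t) (by simpa) (ξ / (2 * Real.pi))
  rw [charFun_apply_real, integral_cauchyLaw ht]
  calc _ = _ := integral_congr_ae (ae_of_all _ fun x => ?_)
    _ = _ := h
    _ = _ := ?_
  · simp only [Complex.real_smul]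
    rw [mul_comm]
    congr 1
    · congr 2
      rw [← Complex.ofReal_mul]
      congr 1
      field_simp
    · push_cast
      rw [div_mul_div_comm, mul_one]
  · congr 1
    rw [abs_div, abs_of_pos (show 0 < 2 * Real.pi by positivity)]
    push_cast
    field_simp

instance isProbabilityMeasure_convPow (μ : Measure ℝ) [IsProbabilityMeasure μ] (n : ℕ) :
    IsProbabilityMeasure (convPow μ n) := by
  induction n with
  | zero => unfold convPow; infer_instance
  | succ n ih => unfold convPow; infer_instance

lemma charFun_convPow (μ : Measure ℝ) [IsProbabilityMeasure μ] (n : ℕ) (ξ : ℝ) :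
    charFun (convPow μ n) ξ = charFun μ ξ ^ n := by
  induction n with
  | zero => simp [convPow]
  | succ n ih => rw [convPow, charFun_conv, ih, pow_succ]

lemma isInfDiv_cauchyLaw {t : ℝ} (ht : 0 < t) : IsInfDiv (cauchyLaw t) := by
  intro n hn
  have hn' : (0 : ℝ) < n := by exact_mod_cast hn
  refine ⟨cauchyLaw (t / n), inferInstance, Measure.ext_of_charFun (funext fun ξ => ?_)⟩
  rw [charFun_convPow, charFun_cauchyLaw (by positivity), charFun_cauchyLaw ht,
    ← Complex.exp_nat_mul]
  have hnc : (n : ℂ) ≠ 0 := by exact_mod_cast hn'.ne'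
  congr 1
  push_cast
  field_simp

/-! ### The Lévy measure of the Cauchy law -/

/-- The Lévy measure of the Cauchy law with parameter `t`: in the normalisation with the factor
`(1 + x ^ 2) / x ^ 2` it is the finite measure `t / (π (1 + x ^ 2)) dx`. -/
def cauchyLevy (t : ℝ) : Measure ℝ := ENNReal.ofReal t • cauchyLaw 1

lemma isSymmFinite_cauchyLevy (t : ℝ) : IsSymmFinite (cauchyLevy t) where
  isFinite := by unfold cauchyLevy; exact Measure.smul_finite _ ENNReal.ofReal_ne_top
  symm := by rw [cauchyLevy, Measure.map_smul, (isSymmProb_cauchyLaw one_pos).symm]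

lemma integral_cos_cauchyLaw {t : ℝ} (ht : 0 < t) (ξ : ℝ) :
    ∫ x, Real.cos (x * ξ) ∂(cauchyLaw t) = Real.exp (-(t * |ξ|)) := by
  have h := congrArg Complex.re (charFun_cauchyLaw ht ξ)
  rw [charFun_apply_real, ← Complex.ofReal_exp, Complex.ofReal_re] at h
  rw [← h, ← Complex.reCLM_apply, ← ContinuousLinearMap.integral_comp_comm]
  · congr 1
    ext x
    rw [Complex.reCLM_apply, ← Complex.ofReal_mul, Complex.exp_ofReal_mul_I_re, mul_comm]
  · refine Integrable.of_bound (C := 1) (by fun_prop) (ae_of_all _ fun x => ?_)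
    rw [← Complex.ofReal_mul, Complex.norm_exp_ofReal_mul_I]

lemma integrable_one_sub_cos_div_sq (ξ : ℝ) :
    Integrable fun x : ℝ => (1 - Real.cos (x * ξ)) / x ^ 2 := by
  have hb := (integrable_inv_sq_add_sq one_pos).const_mul (ξ ^ 2 + 2)
  refine hb.mono' (Measurable.aestronglyMeasurable (by fun_prop)) (ae_of_all _ fun x => ?_)
  have h0 : 0 ≤ 1 - Real.cos (x * ξ) := by linarith [Real.cos_le_one (x * ξ)]
  rw [Real.norm_of_nonneg (by positivity)]
  rcases eq_or_ne x 0 with rfl | hx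
  · simp; positivity
  have hx2 : 0 < x ^ 2 := by positivity
  rw [mul_one_div, div_le_div_iff₀ hx2 (by positivity)]
  have h1 : 1 - Real.cos (x * ξ) ≤ 2 := by linarith [Real.neg_one_le_cos (x * ξ)]
  have h2 : 1 - Real.cos (x * ξ) ≤ (x * ξ) ^ 2 / 2 := by
    linarith [Real.one_sub_sq_div_two_le_cos (x := x * ξ)]
  nlinarith

/-- The limit `ε → 0` of `∫ (1 - cos (x ξ)) / (ε ^ 2 + x ^ 2) = π (1 - exp (-ε |ξ|)) / ε`. -/
lemma integral_one_sub_cos_div_sq (ξ : ℝ) :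
    ∫ x : ℝ, (1 - Real.cos (x * ξ)) / x ^ 2 = Real.pi * |ξ| := by
  have hpi := Real.pi_pos
  have key : ∀ ε : ℝ, 0 < ε → ∫ x : ℝ, (1 - Real.cos (x * ξ)) / (ε ^ 2 + x ^ 2) =
      Real.pi * ((1 - Real.exp (-(ε * |ξ|))) / ε) := by
    intro ε hε
    have h : ∫ x, (1 - Real.cos (x * ξ)) ∂(cauchyLaw ε) = 1 - Real.exp (-(ε * |ξ|)) := by
      rw [integral_sub (integrable_const _), integral_cos_cauchyLaw hε]
      · simp
      · exact Integrable.of_bound (C := 1) (by fun_prop)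
          (ae_of_all _ fun x => Real.abs_cos_le_one _)
    rw [integral_cauchyLaw hε] at h
    rw [← h, ← mul_div_assoc, ← integral_const_mul, ← integral_div]
    congr 1
    ext x
    simp only [smul_eq_mul]
    field_simp
  have l1 : Tendsto (fun ε : ℝ => ∫ x : ℝ, (1 - Real.cos (x * ξ)) / (ε ^ 2 + x ^ 2))
      (𝓝[>] 0) (𝓝 (∫ x : ℝ, (1 - Real.cos (x * ξ)) / x ^ 2)) := by
    refine tendsto_integral_filter_of_dominated_convergence _
      (Eventually.of_forall fun ε => Measurable.aestronglyMeasurable (by fun_prop)) ?_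
      (integrable_one_sub_cos_div_sq ξ) ?_
    · refine Eventually.of_forall fun ε => ?_
      filter_upwards [compl_mem_ae_iff.2 (measure_singleton (0 : ℝ))] with x hx
      have hx' : x ≠ 0 := by simpa using hx
      have h0 : 0 ≤ 1 - Real.cos (x * ξ) := by linarith [Real.cos_le_one (x * ξ)]
      rw [Real.norm_of_nonneg (by positivity)]
      gcongr
      nlinarith [sq_nonneg ε]
    · filter_upwards [compl_mem_ae_iff.2 (measure_singleton (0 : ℝ))] with x hx
      have hx' : x ≠ 0 := by simpa using hx
      have : ContinuousAt (fun ε : ℝ => (1 - Real.cos (x * ξ)) / (ε ^ 2 + x ^ 2)) 0 :=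
        ContinuousAt.div (by fun_prop) (by fun_prop) (by positivity)
      simpa using this.tendsto.mono_left nhdsWithin_le_nhds
  have l2 : Tendsto (fun ε : ℝ => Real.pi * ((1 - Real.exp (-(ε * |ξ|))) / ε))
      (𝓝[>] 0) (𝓝 (Real.pi * |ξ|)) := by
    refine Tendsto.const_mul _ ?_
    have hd : HasDerivAt (fun ε : ℝ => 1 - Real.exp (-(ε * |ξ|))) |ξ| 0 := by
      have := (((hasDerivAt_id (0 : ℝ)).mul_const |ξ|).neg.exp).const_sub 1
      simpa using this
    have := hd.tendsto_slope_zero_right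
    refine this.congr fun ε => ?_
    simp [div_eq_inv_mul]
  refine tendsto_nhds_unique l1 (l2.congr' ?_)
  filter_upwards [self_mem_nhdsWithin] with ε hε using (key ε hε).symm

lemma isClassicalLevy_cauchyLaw {t : ℝ} (ht : 0 < t) :
    IsClassicalLevy (cauchyLaw t) (cauchyLevy t) := by
  refine ⟨isSymmFinite_cauchyLevy t, fun ξ => ?_⟩
  rw [charFun_cauchyLaw ht]
  congr 2
  have hpi := Real.pi_pos
  rw [cauchyLevy, integral_smul_measure, ENNReal.toReal_ofReal ht.le, smul_eq_mul,
    integral_cauchyLaw one_pos]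
  have : ∫ x : ℝ, (1 / (Real.pi * (1 ^ 2 + x ^ 2))) • levyKernel ξ x =
      ∫ x : ℝ, -Real.pi⁻¹ * ((1 - Real.cos (x * ξ)) / x ^ 2) := by
    refine integral_congr_ae ?_
    filter_upwards [compl_mem_ae_iff.2 (measure_singleton (0 : ℝ))] with x hx
    have hx' : x ≠ 0 := by simpa using hx
    simp only [levyKernel, hx', if_false, smul_eq_mul]
    field_simp
    ring
  rw [this, integral_const_mul, integral_one_sub_cos_div_sq]
  field_simp

/-! ### Symmetric measures and uniqueness of the Lévy measure -/

lemma integral_comp_neg_of_symm {E : Type*} [NormedAddCommGroup E] [NormedSpace ℝ E]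
    {μ : Measure ℝ} (hμ : μ.map (fun x => -x) = μ) (f : ℝ → E) :
    ∫ x, f (-x) ∂μ = ∫ x, f x ∂μ := by
  conv_rhs => rw [← hμ]
  exact (integral_map_equiv (MeasurableEquiv.neg ℝ) f).symm

/-- Against a symmetric measure, an even weight times `exp (i ξ x)` has the same integral as the
weight times `cos (x ξ)`. -/
lemma integral_exp_mul_of_symm {μ : Measure ℝ} [IsFiniteMeasure μ]
    (hμ : μ.map (fun x => -x) = μ) {w : ℝ → ℝ} (hw : Integrable w μ)
    (hwe : ∀ x, w (-x) = w x) (ξ : ℝ) :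
    ∫ x, w x • Complex.exp (ξ * x * Complex.I) ∂μ = (∫ x, Real.cos (x * ξ) * w x ∂μ : ℝ) := by
  have hi : Integrable (fun x : ℝ => w x • Complex.exp (ξ * x * Complex.I)) μ := by
    simp only [Complex.real_smul]
    refine hw.ofReal.mul_bdd (c := 1) (by fun_prop) (ae_of_all _ fun x => ?_)
    rw [← Complex.ofReal_mul, Complex.norm_exp_ofReal_mul_I]
  have hi' : Integrable (fun x : ℝ => w x • Complex.exp (ξ * (-x) * Complex.I)) μ := by
    simp only [Complex.real_smul]
    refine hw.ofReal.mul_bdd (c := 1) (by fun_prop) (ae_of_all _ fun x => ?_)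
    rw [← Complex.ofReal_neg, ← Complex.ofReal_mul, Complex.norm_exp_ofReal_mul_I]
  have h1 := integral_comp_neg_of_symm hμ (fun x => w x • Complex.exp (ξ * x * Complex.I))
  simp only [hwe, Complex.ofReal_neg] at h1
  have h2 : ∫ x, w x • Complex.exp (ξ * x * Complex.I) ∂μ =
      2⁻¹ * (∫ x, w x • Complex.exp (ξ * x * Complex.I) ∂μ +
        ∫ x, w x • Complex.exp (ξ * (-x) * Complex.I) ∂μ) := by
    rw [h1]; ring
  rw [h2, ← integral_add hi hi', ← integral_const_mul, ← integral_complex_ofReal]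
  congr 1
  ext x
  simp only [Complex.real_smul, Complex.ofReal_mul, Complex.ofReal_cos, Complex.cos]
  rw [show ((x * ξ : ℂ)) * Complex.I = ξ * x * Complex.I by ring,
    show (-(x * ξ : ℂ)) * Complex.I = ξ * (-x) * Complex.I by ring]
  ring

lemma charFun_of_symm {μ : Measure ℝ} [IsFiniteMeasure μ]
    (hμ : μ.map (fun x => -x) = μ) (ξ : ℝ) :
    charFun μ ξ = (∫ x, Real.cos (x * ξ) ∂μ : ℝ) := by
  have := integral_exp_mul_of_symm hμ (w := fun _ => 1) (integrable_const _) (fun _ => rfl) ξ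
  simpa [charFun_apply_real] using this

lemma measurable_levyKernel (ξ : ℝ) : Measurable (levyKernel ξ) := by
  unfold levyKernel
  exact Measurable.ite (measurableSet_singleton 0) (by fun_prop) (by fun_prop)

lemma levyKernel_nonpos (ξ x : ℝ) : levyKernel ξ x ≤ 0 := by
  unfold levyKernel
  split_ifs
  · nlinarith [sq_nonneg ξ]
  · have : Real.cos (x * ξ) - 1 ≤ 0 := by linarith [Real.cos_le_one (x * ξ)]
    exact mul_nonpos_of_nonpos_of_nonneg this (by positivity)

lemma neg_levyKernel_le (ξ x : ℝ) : -levyKernel ξ x ≤ ξ ^ 2 / 2 + 2 := by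
  unfold levyKernel
  split_ifs with h
  · linarith
  · have h1 : 1 - Real.cos (x * ξ) ≤ 2 := by linarith [Real.neg_one_le_cos (x * ξ)]
    have h2 : 1 - Real.cos (x * ξ) ≤ (x * ξ) ^ 2 / 2 := by
      linarith [Real.one_sub_sq_div_two_le_cos (x := x * ξ)]
    have hx2 : 0 < x ^ 2 := by positivity
    rw [← neg_mul, ← mul_div_assoc, div_le_iff₀ hx2]
    nlinarith

lemma integrable_levyKernel {G : Measure ℝ} [IsFiniteMeasure G] (ξ : ℝ) :
    Integrable (levyKernel ξ) G := by
  refine Integrable.of_bound (C := ξ ^ 2 / 2 + 2) (measurable_levyKernel ξ).aestronglyMeasurable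
    (ae_of_all _ fun x => ?_)
  rw [Real.norm_of_nonpos (levyKernel_nonpos ξ x)]
  exact neg_levyKernel_le ξ x

lemma levyKernel_neg (ξ x : ℝ) : levyKernel ξ (-x) = levyKernel ξ x := by
  simp [levyKernel]

/-- The second difference of the Lévy kernel in the frequency is a cosine times a weight, so that
the Lévy-Khinchine exponent determines the cosine transform of the weighted Lévy measure. -/
lemma levyKernel_second_difference (ξ h x : ℝ) :
    levyKernel (ξ + h) x + levyKernel (ξ - h) x - 2 * levyKernel ξ x =
      2 * (Real.cos (x * ξ) * levyKernel h x) := by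
  unfold levyKernel
  split_ifs with h0
  · subst h0; simp; ring
  · rw [mul_add, mul_sub, Real.cos_add, Real.cos_sub]
    ring

lemma levyKernel_neg_of_cos_ne_one {ξ x : ℝ} (h : x ≠ 0) (hc : Real.cos (x * ξ) ≠ 1) :
    levyKernel ξ x < 0 := by
  have : Real.cos (x * ξ) - 1 < 0 := by
    linarith [lt_of_le_of_ne (Real.cos_le_one (x * ξ)) hc]
  simp only [levyKernel, h, if_false]
  exact mul_neg_of_neg_of_pos this (by positivity)

/-- The frequencies `1` and `√2` are incommensurable, so the two weights have no common zero. -/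
lemma levyKernel_one_add_levyKernel_sqrt_two_neg (x : ℝ) :
    levyKernel 1 x + levyKernel (√2) x < 0 := by
  have hn1 := levyKernel_nonpos 1 x
  have hn2 := levyKernel_nonpos (√2) x
  rcases eq_or_ne x 0 with rfl | hx
  · have : levyKernel 1 0 < 0 := by norm_num [levyKernel]
    linarith
  by_cases h1 : Real.cos (x * 1) = 1
  · by_cases h2 : Real.cos (x * √2) = 1
    · exfalso
      rw [mul_one, Real.cos_eq_one_iff] at h1
      rw [Real.cos_eq_one_iff] at h2
      obtain ⟨m, hm⟩ := h1
      obtain ⟨n, hn⟩ := h2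
      have hpi := Real.pi_pos
      have hm0 : (m : ℝ) ≠ 0 := by rintro h; apply hx; rw [← hm, h, zero_mul]
      have : √2 = ((n / m : ℚ) : ℝ) := by
        push_cast
        rw [eq_div_iff hm0]
        have : (2 * Real.pi) * (√2 * m) = (2 * Real.pi) * n := by rw [← hm] at hn; linarith
        exact mul_left_cancel₀ (by positivity) this
      exact irrational_sqrt_two ⟨_, this.symm⟩
    · linarith [levyKernel_neg_of_cos_ne_one hx h2]
  · linarith [levyKernel_neg_of_cos_ne_one hx h1]

/-- The symmetric Lévy-Khinchine exponent determines the Lévy measure. -/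
lemma IsSymmFinite.eq_of_integral_levyKernel_eq {G G' : Measure ℝ} (hG : IsSymmFinite G)
    (hG' : IsSymmFinite G')
    (h : ∀ ξ, ∫ x, levyKernel ξ x ∂G = ∫ x, levyKernel ξ x ∂G') : G = G' := by
  have := hG.isFinite
  have := hG'.isFinite
  -- a positive weight; both weighted measures have the same characteristic function
  set w : ℝ → ℝ := fun x => -levyKernel 1 x - levyKernel (√2) x with hw
  have hwm : Measurable w := (measurable_levyKernel 1).neg.sub (measurable_levyKernel _)
  have hwpos : ∀ x, 0 < w x := fun x => by
    have := levyKernel_one_add_levyKernel_sqrt_two_neg x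
    simp only [hw]; linarith
  have hwi : ∀ (m : Measure ℝ) [IsFiniteMeasure m], Integrable w m := fun m _ =>
    (integrable_levyKernel 1).neg.sub (integrable_levyKernel _)
  have hwe : ∀ x, w (-x) = w x := fun x => by simp [hw, levyKernel_neg]
  have second : ∀ (m : Measure ℝ) [IsFiniteMeasure m] (ξ η : ℝ),
      ∫ x, Real.cos (x * ξ) * levyKernel η x ∂m =
        2⁻¹ * (∫ x, levyKernel (ξ + η) x ∂m + ∫ x, levyKernel (ξ - η) x ∂m -
          2 * ∫ x, levyKernel ξ x ∂m) := by
    intro m _ ξ η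
    rw [← integral_const_mul,
      ← integral_add (integrable_levyKernel _) (integrable_levyKernel _),
      ← integral_sub (f := fun x => levyKernel (ξ + η) x + levyKernel (ξ - η) x)
        ((integrable_levyKernel _).add (integrable_levyKernel _))
        ((integrable_levyKernel _).const_mul _), ← integral_const_mul]
    congr 1
    ext x
    rw [levyKernel_second_difference]
    ring
  have hcosi : ∀ (m : Measure ℝ) [IsFiniteMeasure m] (ξ η : ℝ),
      Integrable (fun x => Real.cos (x * ξ) * levyKernel η x) m := fun m _ ξ η =>
    (integrable_levyKernel η).bdd_mul (c := 1) (by fun_prop)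
      (ae_of_all _ fun x => Real.abs_cos_le_one _)
  have hcos : ∀ (m : Measure ℝ) [IsFiniteMeasure m] (ξ : ℝ), ∫ x, Real.cos (x * ξ) * w x ∂m =
      -∫ x, Real.cos (x * ξ) * levyKernel 1 x ∂m -
        ∫ x, Real.cos (x * ξ) * levyKernel (√2) x ∂m := by
    intro m _ ξ
    rw [← neg_add', ← integral_add (hcosi m ξ 1) (hcosi m ξ _), ← integral_neg]
    congr 1
    ext x
    simp only [hw]; ring
  have hchar : ∀ (m : Measure ℝ) [IsFiniteMeasure m], m.map (fun x => -x) = m → ∀ ξ,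
      charFun (m.withDensity fun x => ENNReal.ofReal (w x)) ξ =
        (∫ x, Real.cos (x * ξ) * w x ∂m : ℝ) := by
    intro m _ hm ξ
    rw [charFun_apply_real, integral_withDensity_eq_integral_toReal_smul (by fun_prop) (by simp),
      ← integral_exp_mul_of_symm hm (hwi m) hwe]
    simp only [ENNReal.toReal_ofReal (hwpos _).le]
  have := isFiniteMeasure_withDensity_ofReal (hwi G).2
  have := isFiniteMeasure_withDensity_ofReal (hwi G').2
  have heq : G.withDensity (fun x => ENNReal.ofReal (w x)) =
      G'.withDensity fun x => ENNReal.ofReal (w x) := by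
    refine Measure.ext_of_charFun (funext fun ξ => ?_)
    rw [hchar G hG.symm, hchar G' hG'.symm, hcos, hcos]
    simp only [second, h]
  have hm : Measurable fun x => ENNReal.ofReal (w x) := by fun_prop
  rw [← withDensity_inv_same (μ := G) hm (ae_of_all _ fun x => by simpa using hwpos x)
      (ae_of_all _ fun x => by simp), heq,
    withDensity_inv_same hm (ae_of_all _ fun x => by simpa using hwpos x)
      (ae_of_all _ fun x => by simp)]

lemma IsClassicalLevy.unique {μ G G' : Measure ℝ} (h : IsClassicalLevy μ G)
    (h' : IsClassicalLevy μ G') : G = G' := by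
  refine h.1.eq_of_integral_levyKernel_eq h'.1 fun ξ => ?_
  have := (h.2 ξ).symm.trans (h'.2 ξ)
  rw [← Complex.ofReal_exp, ← Complex.ofReal_exp, Complex.ofReal_inj] at this
  exact Real.exp_injective this

/-! ### Rational integrals -/

section

variable {a b k : ℂ}

lemma norm_inv_sq_add_sq_le (hb : 0 < b.re) (y : ℝ) :
    ‖1 / (b ^ 2 + (y : ℂ) ^ 2)‖ ≤ 1 / (b.re * b.re) := by
  have h1 : b.re ≤ ‖b + y * Complex.I‖ := by
    simpa using Complex.re_le_norm (b + y * Complex.I)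
  have h2 : b.re ≤ ‖b - y * Complex.I‖ := by
    simpa using Complex.re_le_norm (b - y * Complex.I)
  rw [sq_add_sq_eq_mul, norm_div, norm_mul, norm_one]
  gcongr

lemma integrable_inv_mul_inv (ha : 0 < a.re) (hb : 0 < b.re) :
    Integrable fun y : ℝ => 1 / (a ^ 2 + (y : ℂ) ^ 2) * (1 / (b ^ 2 + (y : ℂ) ^ 2)) :=
  (integrable_complex_inv_sq_add_sq hb).bdd_mul (continuous_inv_sq_add_sq ha).aestronglyMeasurable
    (ae_of_all _ (norm_inv_sq_add_sq_le ha))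

lemma sq_div_mul_eq (ha : 0 < a.re) (hb : 0 < b.re) (y : ℝ) :
    (y : ℂ) ^ 2 / ((a ^ 2 + (y : ℂ) ^ 2) * (b ^ 2 + (y : ℂ) ^ 2)) =
      1 / (b ^ 2 + (y : ℂ) ^ 2) -
        a ^ 2 * (1 / (a ^ 2 + (y : ℂ) ^ 2) * (1 / (b ^ 2 + (y : ℂ) ^ 2))) := by
  have h1 := sq_add_sq_ne_zero ha y
  have h2 := sq_add_sq_ne_zero hb y
  field_simp
  ring

lemma integrable_sq_div_mul_of_re_pos (ha : 0 < a.re) (hb : 0 < b.re) :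
    Integrable fun y : ℝ =>
      (y : ℂ) ^ 2 / ((a ^ 2 + (y : ℂ) ^ 2) * (b ^ 2 + (y : ℂ) ^ 2)) := by
  simp only [sq_div_mul_eq ha hb]
  exact (integrable_complex_inv_sq_add_sq hb).sub ((integrable_inv_mul_inv ha hb).const_mul _)

lemma tendsto_div_sq_add_sq_cobounded (b : ℂ) :
    Tendsto (fun z : ℂ => z / (b ^ 2 + z ^ 2)) (Bornology.cobounded ℂ) (𝓝 0) := by
  have h1 : Tendsto (fun z : ℂ => z⁻¹) (Bornology.cobounded ℂ) (𝓝 0) :=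
    tendsto_inv₀_cobounded
  have h2 : Tendsto (fun z : ℂ => z⁻¹ * (b ^ 2 * z⁻¹ ^ 2 + 1)⁻¹) (Bornology.cobounded ℂ)
      (𝓝 (0 * (b ^ 2 * 0 ^ 2 + 1)⁻¹)) :=
    h1.mul ((((h1.pow 2).const_mul _).add_const 1).inv₀ (by simp))
  rw [zero_mul] at h2
  refine h2.congr' ?_
  filter_upwards [Bornology.le_cofinite ℂ (finite_singleton (0 : ℂ)).compl_mem_cofinite]
    with z hz
  have hz0 : z ≠ 0 := by simpa using hz
  rw [← mul_inv, div_eq_mul_inv]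
  by_cases h : b ^ 2 + z ^ 2 = 0
  · have : b ^ 2 * z⁻¹ ^ 2 + 1 = 0 := by
      rw [← mul_left_inj' (pow_ne_zero 2 hz0), zero_mul, ← h]
      field_simp
    rw [this, h]; simp
  · field_simp

/-- The double-pole case, from the vanishing integral of the derivative of `y / (b ^ 2 + y ^ 2)`. -/
lemma integral_sq_div_sq (hb : 0 < b.re) :
    ∫ y : ℝ, (y : ℂ) ^ 2 / ((b ^ 2 + (y : ℂ) ^ 2) * (b ^ 2 + (y : ℂ) ^ 2)) =
      Real.pi / (b + b) := by
  have hb0 : b ≠ 0 := fun h => by simp [h] at hb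
  set f' : ℝ → ℂ := fun y => 1 / (b ^ 2 + (y : ℂ) ^ 2) -
    2 * ((y : ℂ) ^ 2 / ((b ^ 2 + (y : ℂ) ^ 2) * (b ^ 2 + (y : ℂ) ^ 2))) with hf'
  have hd : ∀ y : ℝ, HasDerivAt (fun y : ℝ => (y : ℂ) / (b ^ 2 + (y : ℂ) ^ 2)) (f' y) y := by
    intro y
    have h2 := sq_add_sq_ne_zero hb y
    have hy : HasDerivAt (fun y : ℝ => (y : ℂ)) 1 y := Complex.ofRealCLM.hasDerivAt
    have := hy.div ((hy.pow 2).const_add (b ^ 2)) h2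
    refine this.congr_deriv ?_
    simp only [hf', Pi.pow_apply]
    field_simp
    push_cast
    ring
  have htop := (tendsto_div_sq_add_sq_cobounded b).comp
    (RCLike.tendsto_ofReal_atTop_cobounded ℂ)
  have hbot := (tendsto_div_sq_add_sq_cobounded b).comp
    (RCLike.tendsto_ofReal_atBot_cobounded ℂ)
  have h := integral_of_hasDerivAt_of_tendsto hd
    ((integrable_complex_inv_sq_add_sq hb).sub
      ((integrable_sq_div_mul_of_re_pos hb hb).const_mul 2)) hbot htop
  simp only [hf'] at h
  rw [integral_sub (integrable_complex_inv_sq_add_sq hb)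
    ((integrable_sq_div_mul_of_re_pos hb hb).const_mul 2), integral_const_mul,
    integral_complex_inv_sq_add_sq hb] at h
  rw [← two_mul, mul_comm, ← div_div, eq_div_iff two_ne_zero]
  linear_combination -h

lemma ae_zero_sq_div_mul :
    (fun y : ℝ => 1 / (b ^ 2 + (y : ℂ) ^ 2)) =ᵐ[volume]
      fun y : ℝ => (y : ℂ) ^ 2 / (((0 : ℂ) ^ 2 + (y : ℂ) ^ 2) * (b ^ 2 + (y : ℂ) ^ 2)) := by
  filter_upwards [compl_mem_ae_iff.2 (measure_singleton (0 : ℝ))] with y hy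
  have hy' : (y : ℂ) ≠ 0 := by simpa using hy
  rw [zero_pow two_ne_zero, zero_add, div_mul_eq_div_div, div_self (pow_ne_zero 2 hy')]

lemma integrable_sq_div_mul (ha : a = 0 ∨ 0 < a.re) (hb : 0 < b.re) :
    Integrable fun y : ℝ =>
      (y : ℂ) ^ 2 / ((a ^ 2 + (y : ℂ) ^ 2) * (b ^ 2 + (y : ℂ) ^ 2)) := by
  rcases ha with rfl | ha
  · exact (integrable_complex_inv_sq_add_sq hb).congr ae_zero_sq_div_mul
  · exact integrable_sq_div_mul_of_re_pos ha hb

/-- The case `a = 0` is included: there the density `y ^ 2 / (0 + y ^ 2)` is `1` almost everywhere. -/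
lemma integral_sq_div_mul (ha : a = 0 ∨ 0 < a.re) (hb : 0 < b.re) :
    ∫ y : ℝ, (y : ℂ) ^ 2 / ((a ^ 2 + (y : ℂ) ^ 2) * (b ^ 2 + (y : ℂ) ^ 2)) =
      Real.pi / (a + b) := by
  have hb0 : b ≠ 0 := fun h => by simp [h] at hb
  rcases ha with rfl | ha
  · rw [← integral_congr_ae ae_zero_sq_div_mul, integral_complex_inv_sq_add_sq hb, zero_add]
  have ha0 : a ≠ 0 := fun h => by simp [h] at ha
  have hab : a + b ≠ 0 := fun h => by
    have := congrArg Complex.re h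
    simp at this
    linarith
  rcases eq_or_ne a b with rfl | hne
  · exact integral_sq_div_sq ha
  have hd : a - b ≠ 0 := sub_ne_zero.2 hne
  have hd2 : a ^ 2 - b ^ 2 ≠ 0 := by
    rw [sq_sub_sq]; exact mul_ne_zero hab hd
  have e : ∀ y : ℝ, (y : ℂ) ^ 2 / ((a ^ 2 + (y : ℂ) ^ 2) * (b ^ 2 + (y : ℂ) ^ 2)) =
      (a ^ 2 / (a ^ 2 - b ^ 2)) * (1 / (a ^ 2 + (y : ℂ) ^ 2)) -
        (b ^ 2 / (a ^ 2 - b ^ 2)) * (1 / (b ^ 2 + (y : ℂ) ^ 2)) := by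
    intro y
    have h1 := sq_add_sq_ne_zero ha y
    have h2 := sq_add_sq_ne_zero hb y
    field_simp
    ring
  simp only [e]
  rw [integral_sub ((integrable_complex_inv_sq_add_sq ha).const_mul _)
    ((integrable_complex_inv_sq_add_sq hb).const_mul _), integral_const_mul, integral_const_mul,
    integral_complex_inv_sq_add_sq ha, integral_complex_inv_sq_add_sq hb, sq_sub_sq]
  field_simp

/-- Only `k ^ 2 ≠ a ^ 2` is needed: partial fractions in these two poles leave two integrals of the
previous kind, in which coinciding poles are allowed. -/
lemma integral_sq_div_mul_mul (ha : a = 0 ∨ 0 < a.re) (hb : 0 < b.re) (hk : 0 < k.re)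
    (hka : k ^ 2 - a ^ 2 ≠ 0) :
    ∫ y : ℝ, (y : ℂ) ^ 2 / ((a ^ 2 + (y : ℂ) ^ 2) * (b ^ 2 + (y : ℂ) ^ 2)) *
        (1 / (k ^ 2 + (y : ℂ) ^ 2)) =
      Real.pi / ((a + b) * (k + b) * (k + a)) := by
  have hab : a + b ≠ 0 := fun h => by
    rcases ha with rfl | ha
    · rw [zero_add] at h
      simp [h] at hb
    · have := congrArg Complex.re h
      simp at this
      linarith
  have hkb : k + b ≠ 0 := fun h => by
    have := congrArg Complex.re h
    simp at this
    linarith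
  have hka' := hka
  rw [sq_sub_sq] at hka'
  have e : (fun y : ℝ => (y : ℂ) ^ 2 / ((a ^ 2 + (y : ℂ) ^ 2) * (b ^ 2 + (y : ℂ) ^ 2)) *
        (1 / (k ^ 2 + (y : ℂ) ^ 2))) =ᵐ[volume] fun y : ℝ =>
      1 / (k ^ 2 - a ^ 2) * ((y : ℂ) ^ 2 / ((a ^ 2 + (y : ℂ) ^ 2) * (b ^ 2 + (y : ℂ) ^ 2)) -
        (y : ℂ) ^ 2 / ((k ^ 2 + (y : ℂ) ^ 2) * (b ^ 2 + (y : ℂ) ^ 2))) := by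
    filter_upwards [compl_mem_ae_iff.2 (measure_singleton (0 : ℝ))] with y hy
    have hy' : (y : ℂ) ≠ 0 := by simpa using hy
    have h1 : a ^ 2 + (y : ℂ) ^ 2 ≠ 0 := by
      rcases ha with rfl | ha
      · simpa using hy'
      · exact sq_add_sq_ne_zero ha y
    have h2 := sq_add_sq_ne_zero hb y
    have h3 := sq_add_sq_ne_zero hk y
    field_simp
    ring
  rw [integral_congr_ae e, integral_const_mul, integral_sub (integrable_sq_div_mul ha hb)
    (integrable_sq_div_mul (Or.inr hk) hb), integral_sq_div_mul ha hb,
    integral_sq_div_mul (Or.inr hk) hb, sq_sub_sq]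
  have h1 := left_ne_zero_of_mul hka'
  have h2 := right_ne_zero_of_mul hka'
  have h3 : 1 / (a + b) - 1 / (k + b) = (k - a) / ((a + b) * (k + b)) := by
    rw [div_sub_div _ _ hab hkb]; ring
  calc _ = 1 / ((k + a) * (k - a)) * (Real.pi * (1 / (a + b) - 1 / (k + b))) := by ring
    _ = _ := by
      rw [h3]
      field_simp

end

/-! ### The rectangular Cauchy law -/

/-- The law with density `rectCauchyDensity lam t`. -/
def rectCauchy (lam t : ℝ) : Measure ℝ :=
  volume.withDensity fun x => ENNReal.ofReal (rectCauchyDensity lam t x)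

section

variable {lam t : ℝ}

lemma measurable_rectCauchyDensity : Measurable (rectCauchyDensity lam t) := by
  unfold rectCauchyDensity
  exact Measurable.indicator (by fun_prop) measurableSet_Icc.compl

lemma rectCauchyDensity_nonneg (hlam : lam ∈ Icc (0 : ℝ) 1) (ht : 0 < t) (x : ℝ) :
    0 ≤ rectCauchyDensity lam t x := by
  have := hlam.1
  have := Real.pi_pos
  exact indicator_nonneg (fun y _ => by positivity) x

lemma rectCauchyDensity_neg (x : ℝ) :
    rectCauchyDensity lam t (-x) = rectCauchyDensity lam t x := by
  have : -x ∈ (Icc (-(t * (1 - lam) / 2)) (t * (1 - lam) / 2))ᶜ ↔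
      x ∈ (Icc (-(t * (1 - lam) / 2)) (t * (1 - lam) / 2))ᶜ := by
    simp only [mem_compl_iff, mem_Icc]
    exact not_congr ⟨fun h => ⟨by linarith [h.2], by linarith [h.1]⟩,
      fun h => ⟨by linarith [h.2], by linarith [h.1]⟩⟩
  by_cases hx : x ∈ (Icc (-(t * (1 - lam) / 2)) (t * (1 - lam) / 2))ᶜ
  · simp only [rectCauchyDensity, indicator_of_mem hx, indicator_of_mem (this.2 hx), neg_sq]
  · simp only [rectCauchyDensity, indicator_of_notMem hx, indicator_of_notMem (mt this.1 hx)]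

lemma integral_rectCauchy (hlam : lam ∈ Icc (0 : ℝ) 1) (ht : 0 < t)
    {E : Type*} [NormedAddCommGroup E] [NormedSpace ℝ E] (f : ℝ → E) :
    ∫ x, f x ∂(rectCauchy lam t) = ∫ x, rectCauchyDensity lam t x • f x := by
  rw [rectCauchy, integral_withDensity_eq_integral_toReal_smul
    measurable_rectCauchyDensity.ennreal_ofReal (by simp)]
  simp only [ENNReal.toReal_ofReal (rectCauchyDensity_nonneg hlam ht _)]

lemma integral_of_even {E : Type*} [NormedAddCommGroup E] [NormedSpace ℝ E] {g : ℝ → E}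
    (hg : ∀ x, g (-x) = g x) : ∫ x, g x = (2 : ℝ) • ∫ x in Ioi (0 : ℝ), g x := by
  have e : ∀ x, g x = g ‖x‖ := fun x => by
    rcases abs_choice x with h | h <;> simp [h, hg]
  rw [integral_congr_ae (ae_of_all _ e), integral_fun_norm_addHaar]
  simp [Measure.real]

/-- The substitution `x = √(y ^ 2 + c ^ 2)` maps `(0, ∞)` onto `(c, ∞)`. -/
lemma image_sqrt_sq_add_sq {c : ℝ} (hc : 0 ≤ c) :
    (fun y : ℝ => √(y ^ 2 + c ^ 2)) '' Ioi 0 = Ioi c := by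
  ext x
  simp only [mem_image, mem_Ioi]
  constructor
  · rintro ⟨y, hy, rfl⟩
    exact Real.lt_sqrt_of_sq_lt (by nlinarith)
  · intro hx
    refine ⟨√(x ^ 2 - c ^ 2), Real.sqrt_pos.2 (by nlinarith), ?_⟩
    rw [Real.sq_sqrt (by nlinarith), sub_add_cancel, Real.sqrt_sq (by linarith)]

/-- The rectangular Cauchy law is the image of an explicit rational density under
`y ↦ sign y * √(y ^ 2 + c ^ 2)`; here tested against functions of `x ^ 2`. -/
lemma integral_rectCauchy_sq {c e : ℝ} (hlam : lam ∈ Icc (0 : ℝ) 1) (ht : 0 < t)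
    (hc : c = t * (1 - lam) / 2) (he : e = t * (1 + lam) / 2)
    {E : Type*} [NormedAddCommGroup E] [NormedSpace ℝ E] (h : ℝ → E) :
    ∫ x, h (x ^ 2) ∂(rectCauchy lam t) =
      ∫ y : ℝ, (t / Real.pi * (y ^ 2 / ((c ^ 2 + y ^ 2) * (e ^ 2 + y ^ 2)))) • h (y ^ 2 + c ^ 2) := by
  have hpi := Real.pi_pos
  have hc0 : 0 ≤ c := by
    rw [hc]; have := hlam.2; have : 0 ≤ 1 - lam := by linarith
    positivity
  have hlam0 := hlam.1
  rw [integral_rectCauchy hlam ht]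
  rw [integral_of_even fun x => by rw [rectCauchyDensity_neg, neg_sq],
    integral_of_even fun y => by rw [neg_sq]]
  congr 1
  have hsub : Ioi c ⊆ Ioi (0 : ℝ) := Ioi_subset_Ioi hc0
  have hderiv : ∀ y ∈ Ioi (0 : ℝ), HasDerivWithinAt (fun y : ℝ => √(y ^ 2 + c ^ 2))
      (y / √(y ^ 2 + c ^ 2)) (Ioi 0) y := by
    intro y hy
    have hy0 : 0 < y := hy
    have h0 : y ^ 2 + c ^ 2 ≠ 0 := by positivity
    have := (((hasDerivAt_pow 2 y).add_const (c ^ 2)).sqrt h0).hasDerivWithinAt (s := Ioi 0)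
    refine this.congr_deriv ?_
    rw [pow_one, Nat.cast_two, mul_div_mul_left _ _ two_ne_zero]
  have hinj : InjOn (fun y : ℝ => √(y ^ 2 + c ^ 2)) (Ioi 0) := by
    intro y hy z hz hyz
    have := (Real.sqrt_inj (by positivity) (by positivity)).1 hyz
    exact (sq_eq_sq₀ (le_of_lt hy) (le_of_lt hz)).1 (by linarith)
  calc ∫ x in Ioi (0 : ℝ), rectCauchyDensity lam t x • h (x ^ 2)
      = ∫ x in Ioi c, rectCauchyDensity lam t x • h (x ^ 2) := by
        refine setIntegral_eq_of_subset_of_forall_sdiff_eq_zero measurableSet_Ioi hsub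
          fun x hx => ?_
        have hx0 : 0 < x := hx.1
        have hx1 : x ≤ c := not_lt.1 hx.2
        rw [rectCauchyDensity, indicator_of_notMem, zero_smul]
        rw [← hc]
        exact not_not.2 ⟨by linarith, hx1⟩
    _ = ∫ y in Ioi (0 : ℝ), |y / √(y ^ 2 + c ^ 2)| •
          (rectCauchyDensity lam t (√(y ^ 2 + c ^ 2)) • h (√(y ^ 2 + c ^ 2) ^ 2)) := by
        rw [← image_sqrt_sq_add_sq hc0]
        exact integral_image_eq_integral_abs_deriv_smul measurableSet_Ioi hderiv hinj _
    _ = _ := by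
        refine setIntegral_congr_fun measurableSet_Ioi fun y hy => ?_
        have hy0 : 0 < y := hy
        have hp : 0 < y ^ 2 + c ^ 2 := by positivity
        have hmem : √(y ^ 2 + c ^ 2) ∈ Ioi c := by
          rw [← image_sqrt_sq_add_sq hc0]; exact mem_image_of_mem _ hy
        have hnot : √(y ^ 2 + c ^ 2) ∈ (Icc (-(t * (1 - lam) / 2)) (t * (1 - lam) / 2))ᶜ := by
          rw [← hc]; exact fun hh => not_lt.2 hh.2 hmem
        have hsq : 1 - t ^ 2 * (1 - lam) ^ 2 / (4 * (y ^ 2 + c ^ 2)) =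
            (y / √(y ^ 2 + c ^ 2)) ^ 2 := by
          rw [div_pow, Real.sq_sqrt hp.le]
          field_simp
          rw [hc]; ring
        have he2 : lam * t ^ 2 + (y ^ 2 + c ^ 2) = e ^ 2 + y ^ 2 := by
          rw [hc, he]; ring
        have he3 : 0 < e ^ 2 + y ^ 2 := by positivity
        simp only [rectCauchyDensity]
        rw [indicator_of_mem hnot, smul_smul, Real.sq_sqrt hp.le, hsq, he2,
          Real.sqrt_sq (by positivity), abs_of_pos (by positivity)]
        congr 1
        have hr : √(y ^ 2 + c ^ 2) ^ 2 = c ^ 2 + y ^ 2 := by rw [Real.sq_sqrt hp.le, add_comm]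
        calc _ = t / Real.pi * (y ^ 2 / (√(y ^ 2 + c ^ 2) ^ 2 * (e ^ 2 + y ^ 2))) := by
              field_simp
          _ = _ := by rw [hr]

/-- The Stieltjes transform of the square of a rectangular Cauchy variable. -/
lemma integral_inv_rectCauchy {c e : ℝ} (hlam : lam ∈ Icc (0 : ℝ) 1) (ht : 0 < t)
    (hc : c = t * (1 - lam) / 2) (he : e = t * (1 + lam) / 2) {ζ k : ℂ} (hζ : ζ ≠ 0)
    (hk : 0 < k.re) (hkζ : k ^ 2 = c ^ 2 + ζ ^ 2) :
    ∫ x : ℝ, 1 / (ζ ^ 2 + (x : ℂ) ^ 2) ∂(rectCauchy lam t) = 1 / ((k + e) * (k + c)) := by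
  have hpi' : (Real.pi : ℂ) ≠ 0 := by exact_mod_cast Real.pi_ne_zero
  have ht' : (t : ℂ) ≠ 0 := by exact_mod_cast ht.ne'
  have hc0 : 0 ≤ c := by
    rw [hc]; have := hlam.2; have : 0 ≤ 1 - lam := by linarith
    positivity
  have he0 : 0 < e := by rw [he]; have := hlam.1; positivity
  have hce : (c : ℂ) + e = t := by rw [← Complex.ofReal_add]; congr 1; rw [hc, he]; ring
  have h := integral_rectCauchy_sq hlam ht hc he (fun v : ℝ => 1 / (ζ ^ 2 + (v : ℂ)))
  simp only [Complex.ofReal_pow] at h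
  rw [h]
  -- `c` vanishes exactly when `lam = 1`
  have hcase : (c : ℂ) = 0 ∨ 0 < (c : ℂ).re := by
    rcases hc0.eq_or_lt with h | h
    · left; rw [← h]; simp
    · right; simpa
  have hkc : k ^ 2 - (c : ℂ) ^ 2 ≠ 0 := by
    rw [hkζ, add_sub_cancel_left]; exact pow_ne_zero 2 hζ
  have := integral_sq_div_mul_mul hcase (b := e) (by simpa) hk hkc
  have e1 : ∀ y : ℝ, (t / Real.pi * (y ^ 2 / ((c ^ 2 + y ^ 2) * (e ^ 2 + y ^ 2)))) •
      (1 / (ζ ^ 2 + ((y ^ 2 + c ^ 2 : ℝ) : ℂ))) =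
      (t / Real.pi) * ((y : ℂ) ^ 2 / (((c : ℂ) ^ 2 + (y : ℂ) ^ 2) * ((e : ℂ) ^ 2 + (y : ℂ) ^ 2)) *
        (1 / (k ^ 2 + (y : ℂ) ^ 2))) := by
    intro y
    rw [hkζ, Complex.real_smul]
    push_cast
    rw [show ζ ^ 2 + ((y : ℂ) ^ 2 + (c : ℂ) ^ 2) = (c : ℂ) ^ 2 + ζ ^ 2 + (y : ℂ) ^ 2 by ring]
    ring
  rw [integral_congr_ae (ae_of_all _ e1), integral_const_mul, this, hce]
  field_simp

lemma isSymmProb_rectCauchy (hlam : lam ∈ Icc (0 : ℝ) 1) (ht : 0 < t) :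
    IsSymmProb (rectCauchy lam t) where
  isProb := by
    have hpi := Real.pi_pos
    set c := t * (1 - lam) / 2 with hc
    set e := t * (1 + lam) / 2 with he
    have hc0 : 0 ≤ c := by
      rw [hc]; have := hlam.2; have : 0 ≤ 1 - lam := by linarith
      positivity
    have he0 : 0 < e := by rw [he]; have := hlam.1; positivity
    have hcase : (c : ℂ) = 0 ∨ 0 < (c : ℂ).re := by
      rcases hc0.eq_or_lt with h | h
      · left; rw [← h]; simp
      · right; simpa
    have h := integral_rectCauchy_sq hlam ht hc he (fun _ => (1 : ℝ))
    have h2 := integral_sq_div_mul hcase (b := e) (by simpa)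
    have h3 : ∫ y : ℝ, y ^ 2 / ((c ^ 2 + y ^ 2) * (e ^ 2 + y ^ 2)) = Real.pi / t := by
      have : c + e = t := by rw [hc, he]; ring
      rw [← this, ← Complex.ofReal_inj, ← integral_complex_ofReal]
      push_cast
      exact h2
    simp only [smul_eq_mul, mul_one] at h
    rw [integral_const_mul, h3, integral_const, smul_eq_mul, mul_one] at h
    have h1 : (rectCauchy lam t).real univ = 1 := by rw [h]; field_simp
    exact ⟨by rwa [Measure.real, ENNReal.toReal_eq_one_iff] at h1⟩
  symm := map_neg_withDensity fun x => by rw [rectCauchyDensity_neg]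

end

/-! ### The principal square root of `-z` -/

/-- The principal square root of `-z`; it has positive real part off `[0, ∞)`, and
`rsqrt z = i * negSqrt z`. -/
def negSqrt (z : ℂ) : ℂ := (-z) ^ (1 / 2 : ℂ)

lemma rsqrt_eq (z : ℂ) : rsqrt z = Complex.I * negSqrt z := rfl

lemma cpow_half_sq (w : ℂ) : (w ^ (1 / 2 : ℂ)) ^ 2 = w := by
  rw [one_div]
  exact Complex.cpow_nat_inv_pow w two_ne_zero

lemma negSqrt_sq (z : ℂ) : negSqrt z ^ 2 = -z := cpow_half_sq _

lemma sq_cpow_half {a : ℂ} (ha : 0 < a.re) : (a ^ 2) ^ (1 / 2 : ℂ) = a := by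
  rw [one_div]
  exact Complex.sq_cpow_two_inv ha

lemma negSqrt_neg_sq {a : ℂ} (ha : 0 < a.re) : negSqrt (-a ^ 2) = a := by
  rw [negSqrt, neg_neg, sq_cpow_half ha]

lemma cpow_half_re_pos {w : ℂ} (hw : w ∈ Complex.slitPlane) : 0 < (w ^ (1 / 2 : ℂ)).re := by
  rw [one_div, Complex.cpow_inv_two_re]
  refine Real.sqrt_pos.2 (div_pos ?_ two_pos)
  rcases hw with h | h
  · positivity
  · have := Complex.abs_re_lt_norm.2 h
    linarith [neg_abs_le w.re]

lemma ne_zero_of_re_pos {a : ℂ} (ha : 0 < a.re) : a ≠ 0 := fun h => by simp [h] at ha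

lemma re_inv_pos {a : ℂ} (ha : 0 < a.re) : 0 < (1 / a).re := by
  rw [one_div, Complex.inv_re]
  exact div_pos ha (Complex.normSq_pos.2 (ne_zero_of_re_pos ha))

lemma ofReal_sq_add_sq_mem_slitPlane (c : ℝ) {ζ : ℂ} (hζ : 0 < ζ.re) :
    (c : ℂ) ^ 2 + ζ ^ 2 ∈ Complex.slitPlane := by
  rw [Complex.mem_slitPlane_iff]
  by_cases h : ζ.im = 0
  · left
    simp [sq, h]
    nlinarith [mul_self_nonneg c, mul_pos hζ hζ]
  · right
    simp [sq]
    intro h'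
    rcases mul_eq_zero.1 (show ζ.re * ζ.im = 0 by linarith) with h1 | h1
    · exact hζ.ne' h1
    · exact h h1

lemma sq_sub_ofReal_sq_mem_slitPlane {c : ℝ} (hc : 0 ≤ c) {w : ℂ} (hw : c < w.re) :
    w ^ 2 - (c : ℂ) ^ 2 ∈ Complex.slitPlane := by
  rw [Complex.mem_slitPlane_iff]
  by_cases h : w.im = 0
  · left
    simp [sq, h]
    nlinarith
  · right
    simp [sq]
    intro h'
    rcases mul_eq_zero.1 (show w.re * w.im = 0 by linarith) with h1 | h1
    · linarith
    · exact h h1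

/-! ### Sectors near zero -/

lemma neg_mem_slitPlane_of_mem_sector {α β : ℝ} (hα : α < Real.pi) {z : ℂ}
    (hz : z ∈ sector α β) : -z ∈ Complex.slitPlane := by
  rw [Complex.mem_slitPlane_iff_arg]
  refine ⟨fun h => ?_, neg_ne_zero.2 hz.1⟩
  have := hz.2.1
  rw [h, abs_of_pos Real.pi_pos] at this
  linarith

lemma NearZero.mono {P Q : ℂ → Prop} (hP : NearZero P) (h : ∀ z, P z → Q z) : NearZero Q :=
  fun α hα => let ⟨β, hβ, H⟩ := hP α hα
    ⟨β, hβ, fun z hz => h z (H z hz)⟩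

lemma NearZero.mono_of_ne_zero {P Q : ℂ → Prop} (hP : NearZero P) (h : ∀ z, z ≠ 0 → P z → Q z) :
    NearZero Q :=
  fun α hα => let ⟨β, hβ, H⟩ := hP α hα
    ⟨β, hβ, fun z hz => h z hz.1 (H z hz)⟩

lemma NearZero.and {P Q : ℂ → Prop} (hP : NearZero P) (hQ : NearZero Q) :
    NearZero fun z => P z ∧ Q z := by
  intro α hα
  obtain ⟨β, hβ, H⟩ := hP α hα
  obtain ⟨γ, hγ, K⟩ := hQ α hα
  exact ⟨min β γ, lt_min hβ hγ, fun z hz =>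
    ⟨H z ⟨hz.1, hz.2.1, hz.2.2.trans_le (min_le_left _ _)⟩,
      K z ⟨hz.1, hz.2.1, hz.2.2.trans_le (min_le_right _ _)⟩⟩⟩

lemma nearZero_neg_mem_slitPlane : NearZero fun z => -z ∈ Complex.slitPlane :=
  fun _ hα => ⟨1, one_pos, fun _ hz => neg_mem_slitPlane_of_mem_sector hα.2 hz⟩

/-- Since `negSqrt` halves the argument, `1 / negSqrt z` tends to infinity within a sector about
the positive axis of opening less than `π`, hence its real part tends to infinity. -/
lemma nearZero_lt_re_inv_negSqrt (T : ℝ) : NearZero fun z => T < (1 / negSqrt z).re := by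
  intro α hα
  have hcos : -1 < Real.cos α := by
    rw [← Real.cos_pi]
    exact Real.cos_lt_cos_of_nonneg_of_le_pi hα.1.le le_rfl hα.2
  refine ⟨(1 + Real.cos α) / (2 * (T ^ 2 + 1)), div_pos (by linarith) (by positivity), ?_⟩
  intro z hz
  have hslit := neg_mem_slitPlane_of_mem_sector hα.2 hz
  have hz0 : 0 < ‖z‖ := norm_pos_iff.2 hz.1
  have hq : 0 < (negSqrt z).re := cpow_half_re_pos hslit
  have hre : (negSqrt z).re ^ 2 = (‖z‖ + (-z).re) / 2 := by
    rw [negSqrt, one_div, Complex.cpow_inv_two_re, norm_neg, Real.sq_sqrt]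
    have := Complex.abs_re_le_norm (-z)
    rw [norm_neg] at this
    linarith [neg_abs_le (-z).re]
  have hns : Complex.normSq (negSqrt z) = ‖z‖ := by
    rw [Complex.normSq_eq_norm_sq, ← norm_pow, negSqrt_sq, norm_neg]
  have harg : ‖z‖ * Real.cos α ≤ (-z).re := by
    rw [← Complex.norm_mul_cos_arg (-z), norm_neg, ← Real.cos_abs (Complex.arg (-z))]
    exact mul_le_mul_of_nonneg_left
      (Real.cos_le_cos_of_nonneg_of_le_pi (abs_nonneg _) hα.2.le hz.2.1.le) hz0.le
  have hβ := hz.2.2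
  rw [lt_div_iff₀ (by positivity)] at hβ
  rw [one_div, Complex.inv_re, hns]
  refine lt_of_pow_lt_pow_left₀ 2 (by positivity) ?_
  rw [div_pow, hre, lt_div_iff₀ (by positivity)]
  nlinarith

lemma tendsto_negSqrt_zero : Tendsto negSqrt (𝓝 0) (𝓝 0) := by
  rw [tendsto_zero_iff_norm_tendsto_zero]
  have h : ∀ z, ‖negSqrt z‖ = √‖z‖ := fun z => by
    rw [← norm_neg z, ← negSqrt_sq, norm_pow, Real.sqrt_sq (norm_nonneg _)]
  simp only [h]
  have : Continuous fun z : ℂ => √‖z‖ := by fun_prop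
  simpa using this.tendsto 0

/-! ### The function `H` of a symmetric law -/

lemma norm_inv_sub_mul_I_le {ζ : ℂ} (hζ : 0 < ζ.re) (x : ℝ) :
    ‖1 / (ζ - x * Complex.I)‖ ≤ 1 / ζ.re := by
  have h : ζ.re ≤ ‖ζ - x * Complex.I‖ := by
    simpa using Complex.re_le_norm (ζ - x * Complex.I)
  rw [norm_div, norm_one]
  gcongr

lemma integrable_inv_sub_mul_I (μ : Measure ℝ) [IsFiniteMeasure μ] {ζ : ℂ} (hζ : 0 < ζ.re) :
    Integrable (fun x : ℝ => 1 / (ζ - x * Complex.I)) μ :=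
  Integrable.of_bound (C := 1 / ζ.re)
    (Continuous.div (by fun_prop) (by fun_prop) (sub_mul_I_ne_zero hζ)).aestronglyMeasurable
    (ae_of_all _ (norm_inv_sub_mul_I_le hζ))

/-- The Cauchy transform of a symmetric law in the lower half-plane. -/
lemma cauchyG_neg_I_mul {μ : Measure ℝ} (hμ : IsSymmProb μ) {ζ : ℂ} (hζ : 0 < ζ.re) :
    cauchyG μ (-Complex.I * ζ) = Complex.I * ζ * ∫ x : ℝ, 1 / (ζ ^ 2 + (x : ℂ) ^ 2) ∂μ := by
  have := hμ.isProb
  have h1 : cauchyG μ (-Complex.I * ζ) = ∫ x : ℝ, Complex.I * (1 / (ζ - x * Complex.I)) ∂μ := by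
    refine integral_congr_ae (ae_of_all _ fun x => ?_)
    have h0 := sub_mul_I_ne_zero hζ x
    have h2 : -Complex.I * ζ - x = -Complex.I * (ζ - x * Complex.I) := by
      linear_combination (-(x : ℂ)) * Complex.I_sq
    simp only
    rw [h2, one_div, mul_inv, inv_neg, Complex.inv_I, neg_neg, one_div]
  have h2 : ∫ x : ℝ, 1 / (ζ - x * Complex.I) ∂μ = ∫ x : ℝ, 1 / (ζ + x * Complex.I) ∂μ := by
    rw [← integral_comp_neg_of_symm hμ.symm]
    simp
  have hi : Integrable (fun x : ℝ => 1 / (ζ + x * Complex.I)) μ :=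
    Integrable.of_bound (C := 1 / ζ.re)
      (Continuous.div (by fun_prop) (by fun_prop) (add_mul_I_ne_zero hζ)).aestronglyMeasurable
      (ae_of_all _ fun x => by simpa using norm_inv_sub_mul_I_le hζ (-x))
  have h3 : ∫ x : ℝ, 1 / (ζ - x * Complex.I) ∂μ =
      ζ * ∫ x : ℝ, 1 / (ζ ^ 2 + (x : ℂ) ^ 2) ∂μ := by
    have h4 : ∫ x : ℝ, 1 / (ζ - x * Complex.I) ∂μ = 2⁻¹ * (∫ x : ℝ, 1 / (ζ - x * Complex.I) ∂μ +
        ∫ x : ℝ, 1 / (ζ + x * Complex.I) ∂μ) := by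
      rw [← h2]; ring
    rw [h4, ← integral_add (integrable_inv_sub_mul_I μ hζ) hi, ← integral_const_mul,
      ← integral_const_mul]
    refine integral_congr_ae (ae_of_all _ fun x => ?_)
    have e1 := sub_mul_I_ne_zero hζ x
    have e2 := add_mul_I_ne_zero hζ x
    simp only
    rw [sq_add_sq_eq_mul]
    field_simp
    ring
  rw [h1, integral_const_mul, h3]
  ring

/-- `H` of a symmetric law at `-1 / ζ ^ 2` in terms of the Stieltjes transform of the square. -/
lemma rectH_neg_inv_sq (lam : ℝ) {μ : Measure ℝ} (hμ : IsSymmProb μ) {ζ : ℂ} (hζ : 0 < ζ.re) :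
    rectH lam μ (-(1 / ζ) ^ 2) =
      -(lam * ζ ^ 2 * (∫ x : ℝ, 1 / (ζ ^ 2 + (x : ℂ) ^ 2) ∂μ) ^ 2 +
        (1 - lam) * ∫ x : ℝ, 1 / (ζ ^ 2 + (x : ℂ) ^ 2) ∂μ) := by
  have hζ0 := ne_zero_of_re_pos hζ
  have h1 : rsqrt (-(1 / ζ) ^ 2) = Complex.I * (1 / ζ) := by
    rw [rsqrt_eq, negSqrt_neg_sq (re_inv_pos hζ)]
  have h2 : 1 / (Complex.I * (1 / ζ)) = -Complex.I * ζ := by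
    rw [one_div, mul_inv, Complex.inv_I, one_div, inv_inv]
  rw [rectH, h1, h2, cauchyG_neg_I_mul hμ hζ]
  set m := ∫ x : ℝ, 1 / (ζ ^ 2 + (x : ℂ) ^ 2) ∂μ
  have h3 : (1 - lam : ℂ) * (Complex.I * (1 / ζ)) * (Complex.I * ζ * m) =
      (1 - lam) * m * Complex.I ^ 2 := by
    field_simp
  rw [h3, mul_pow, mul_pow, Complex.I_sq]
  ring

/-! ### The rectangular R-transform of the rectangular Cauchy law -/

section

variable {lam t : ℝ}

/-- With `k ^ 2 = c ^ 2 + ζ ^ 2`, the function `H` of the rectangular Cauchy law is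
`-1 / ζ ^ 2 ↦ -1 / (k + e) ^ 2`. -/
lemma rectH_rectCauchy {c e : ℝ} (hlam : lam ∈ Icc (0 : ℝ) 1) (ht : 0 < t)
    (hc : c = t * (1 - lam) / 2) (he : e = t * (1 + lam) / 2) {ζ k : ℂ} (hζ : 0 < ζ.re)
    (hk : 0 < k.re) (hkζ : k ^ 2 = c ^ 2 + ζ ^ 2) :
    rectH lam (rectCauchy lam t) (-(1 / ζ) ^ 2) = -(1 / (k + e)) ^ 2 := by
  have hc0 : 0 ≤ c := by
    rw [hc]; have := hlam.2; have : 0 ≤ 1 - lam := by linarith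
    positivity
  have he0 : 0 < e := by rw [he]; have := hlam.1; positivity
  have hke : k + e ≠ 0 := ne_zero_of_re_pos (by simp; positivity)
  have hkc : k + c ≠ 0 := ne_zero_of_re_pos (by simp; positivity)
  rw [rectH_neg_inv_sq lam (isSymmProb_rectCauchy hlam ht) hζ,
    integral_inv_rectCauchy hlam ht hc he (ne_zero_of_re_pos hζ) hk hkζ,
    show ζ ^ 2 = (k + c) * (k - c) by linear_combination -hkζ]
  have hec : (e : ℂ) * (1 - lam) = c * (1 + lam) := by
    rw [hc, he]; push_cast; ring
  field_simp
  linear_combination -hec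

/-- The compositional inverse of the function `H` of the rectangular Cauchy law. -/
def rectCauchyInv (lam t : ℝ) (z : ℂ) : ℂ :=
  z / ((1 - t * negSqrt z) * (1 - lam * t * negSqrt z))

/-- In the coordinate `ω = 1 / √(-z)` the inverse is `ω ↦ ζ` with `ζ ^ 2 = (ω - e) ^ 2 - c ^ 2`,
that is, `ω = k + e` solved for `ζ`. -/
lemma rectCauchyInv_neg_inv_sq {c e : ℝ} (hc : c = t * (1 - lam) / 2)
    (he : e = t * (1 + lam) / 2) {ω : ℂ} (hω : 0 < ω.re) :
    rectCauchyInv lam t (-(1 / ω) ^ 2) = -(1 / ((ω - e) ^ 2 - c ^ 2)) := by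
  have hω0 := ne_zero_of_re_pos hω
  have h1 : (ω - e) ^ 2 - (c : ℂ) ^ 2 = (ω - t) * (ω - lam * t) := by
    rw [hc, he]; push_cast; ring
  have h2 : (1 - t * (1 / ω)) * (1 - lam * t * (1 / ω)) =
      (1 / ω) ^ 2 * ((ω - t) * (ω - lam * t)) := by
    field_simp
  rw [rectCauchyInv, negSqrt_neg_sq (re_inv_pos hω), h2, h1, neg_div,
    div_mul_cancel_left₀ (pow_ne_zero 2 (one_div_ne_zero hω0)), one_div]

/-- Off `[0, ∞)`, `z = -1 / ζ ^ 2` with `ζ = 1 / negSqrt z` in the right half-plane. -/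
lemma re_inv_negSqrt_pos_and_neg_inv_sq_eq {z : ℂ} (hz : -z ∈ Complex.slitPlane) :
    0 < (1 / negSqrt z).re ∧ -(1 / (1 / negSqrt z)) ^ 2 = z := by
  refine ⟨re_inv_pos (cpow_half_re_pos hz), ?_⟩
  rw [one_div_one_div, negSqrt_sq, neg_neg]

lemma rectCauchyInv_rectH (hlam : lam ∈ Icc (0 : ℝ) 1) (ht : 0 < t) {z : ℂ}
    (hz : -z ∈ Complex.slitPlane) :
    rectCauchyInv lam t (rectH lam (rectCauchy lam t) z) = z := by
  obtain ⟨hζ, hzζ⟩ := re_inv_negSqrt_pos_and_neg_inv_sq_eq hz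
  set ζ := 1 / negSqrt z
  set c := t * (1 - lam) / 2 with hc
  set e := t * (1 + lam) / 2 with he
  have he0 : 0 < e := by rw [he]; have := hlam.1; positivity
  have hk := cpow_half_re_pos (ofReal_sq_add_sq_mem_slitPlane c hζ)
  have hkζ := cpow_half_sq ((c : ℂ) ^ 2 + ζ ^ 2)
  set k := ((c : ℂ) ^ 2 + ζ ^ 2) ^ (1 / 2 : ℂ)
  rw [← hzζ, rectH_rectCauchy hlam ht hc he hζ hk hkζ,
    rectCauchyInv_neg_inv_sq hc he (by simp; positivity), add_sub_cancel_right, hkζ,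
    add_sub_cancel_left, one_div_pow ζ]

/-- The condition `t < Re (1 / negSqrt z)` puts `ω - e` to the right of `c`, which selects the
branch `k = ω - e` with positive real part. -/
lemma rectH_rectCauchyInv (hlam : lam ∈ Icc (0 : ℝ) 1) (ht : 0 < t) {z : ℂ}
    (hz : -z ∈ Complex.slitPlane) (hzt : t < (1 / negSqrt z).re) :
    rectH lam (rectCauchy lam t) (rectCauchyInv lam t z) = z := by
  obtain ⟨hω, hzω⟩ := re_inv_negSqrt_pos_and_neg_inv_sq_eq hz
  set ω := 1 / negSqrt z
  set c := t * (1 - lam) / 2 with hc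
  set e := t * (1 + lam) / 2 with he
  have hc0 : 0 ≤ c := by
    rw [hc]; have := hlam.2; have : 0 ≤ 1 - lam := by linarith
    positivity
  have hce : c + e = t := by rw [hc, he]; ring
  have hk : c < (ω - e).re := by simp; linarith
  have hslit := sq_sub_ofReal_sq_mem_slitPlane hc0 hk
  have hζ := cpow_half_re_pos hslit
  have hζ2 := cpow_half_sq ((ω - e) ^ 2 - (c : ℂ) ^ 2)
  set ζ := ((ω - e) ^ 2 - (c : ℂ) ^ 2) ^ (1 / 2 : ℂ)
  conv_lhs => rw [← hzω]
  rw [rectCauchyInv_neg_inv_sq hc he hω, ← hζ2, ← one_div_pow,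
    rectH_rectCauchy hlam ht hc he hζ (hc0.trans_lt hk) (by rw [hζ2]; ring), sub_add_cancel, hzω]

lemma one_sub_mul_ne_zero {q : ℂ} {s : ℝ} (hq : s < (1 / q).re) : 1 - s * q ≠ 0 := by
  intro h
  have h0 : q ≠ 0 := by rintro rfl; simp at h
  have : (1 / q) = s := by
    rw [div_eq_iff h0]; linear_combination h
  rw [this] at hq
  simp at hq

lemma rectCauchyInv_denom_ne_zero (hlam : lam ∈ Icc (0 : ℝ) 1) (ht : 0 < t) {q : ℂ}
    (hq : t < (1 / q).re) : (1 - t * q) * (1 - lam * t * q) ≠ 0 := by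
  have : lam * t < (1 / q).re := lt_of_le_of_lt (by nlinarith [hlam.2]) hq
  refine mul_ne_zero (one_sub_mul_ne_zero hq) ?_
  have := one_sub_mul_ne_zero this
  push_cast at this
  exact this

lemma isRectInverse_rectCauchy (hlam : lam ∈ Icc (0 : ℝ) 1) (ht : 0 < t) :
    IsRectInverse lam (rectCauchy lam t) (rectCauchyInv lam t) where
  analytic := by
    intro α hα
    obtain ⟨β, hβ, H⟩ := nearZero_lt_re_inv_negSqrt t α hα
    refine ⟨β, hβ, fun z hz => DifferentiableAt.differentiableWithinAt ?_⟩
    have hslit := neg_mem_slitPlane_of_mem_sector hα.2 hz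
    have hd : DifferentiableAt ℂ negSqrt z := by
      unfold negSqrt
      exact (differentiableAt_id.neg).cpow_const hslit
    have hne := rectCauchyInv_denom_ne_zero hlam ht (H z hz)
    unfold rectCauchyInv
    exact differentiableAt_id.div (by fun_prop) hne
  tendsto := by
    intro α hα
    have h1 : Tendsto (fun z => 1 / ((1 - t * negSqrt z) * (1 - lam * t * negSqrt z)))
        (𝓝[sector α 1] 0) (𝓝 (1 / ((1 - t * 0) * (1 - lam * t * 0)))) := by
      have hq := tendsto_negSqrt_zero.mono_left (nhdsWithin_le_nhds (s := sector α 1))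
      exact tendsto_const_nhds.div (((hq.const_mul _).const_sub 1).mul
        ((hq.const_mul _).const_sub 1)) (by simp)
    simp only [mul_zero, sub_zero, mul_one, div_one] at h1
    refine h1.congr' ?_
    filter_upwards [self_mem_nhdsWithin] with z hz
    rw [rectCauchyInv, div_div_cancel_left' hz.1, one_div]
  right_inv := (nearZero_neg_mem_slitPlane.and (nearZero_lt_re_inv_negSqrt t)).mono
    fun _ hz => rectH_rectCauchyInv hlam ht hz.1 hz.2
  left_inv := nearZero_neg_mem_slitPlane.mono fun _ hz => rectCauchyInv_rectH hlam ht hz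

/-- `rectU` inverts `C ↦ (1 + C) * (1 + lam * C) - 1` for small `C`: the expression under the root
is a perfect square, and smallness selects the principal branch. -/
lemma rectU_mul_sub_one (hlam : lam ∈ Icc (0 : ℝ) 1) {C : ℂ} (hC : ‖C‖ < 1 / 2) :
    rectU lam ((1 + C) * (1 + lam * C) - 1) = C := by
  unfold rectU
  split_ifs with h
  · simp [h]
  have hl0 : 0 < lam := lt_of_le_of_ne hlam.1 (Ne.symm h)
  have hl : (lam : ℂ) ≠ 0 := by exact_mod_cast h
  have h1 : ((lam : ℂ) + 1) ^ 2 + 4 * lam * ((1 + C) * (1 + lam * C) - 1) =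
      (lam + 1 + 2 * lam * C) ^ 2 := by ring
  have h2 : 0 < ((lam : ℂ) + 1 + 2 * lam * C).re := by
    have := Complex.abs_re_le_norm C
    simp
    nlinarith [neg_abs_le C.re]
  rw [h1, sq_cpow_half h2]
  field_simp
  ring

lemma IsRectRTransform.congr {μ : Measure ℝ} {C D : ℂ → ℂ} (h : IsRectRTransform lam μ C)
    (hCD : NearZero fun z => D z = C z) : IsRectRTransform lam μ D := by
  obtain ⟨F, hF, hC⟩ := h
  exact ⟨F, hF, (hC.and hCD).mono fun z hz => hz.2.trans hz.1⟩

lemma isRectRTransform_rectCauchy (hlam : lam ∈ Icc (0 : ℝ) 1) (ht : 0 < t) :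
    IsRectRTransform lam (rectCauchy lam t) (fun z => -t * negSqrt z) := by
  refine ⟨_, isRectInverse_rectCauchy hlam ht, ?_⟩
  refine (nearZero_neg_mem_slitPlane.and (nearZero_lt_re_inv_negSqrt (2 * t))).mono
    fun z ⟨hz, hzt⟩ => ?_
  have hz0 : z ≠ 0 := neg_ne_zero.1 (Complex.slitPlane_ne_zero hz)
  have hq := ne_zero_of_re_pos (cpow_half_re_pos hz)
  change negSqrt z ≠ 0 at hq
  have hden := rectCauchyInv_denom_ne_zero hlam ht (show t < (1 / negSqrt z).re by linarith)
  have hnorm : ‖-t * negSqrt z‖ < 1 / 2 := by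
    have h1 := hzt.trans_le (Complex.re_le_norm _)
    rw [norm_div, norm_one, lt_div_iff₀ (norm_pos_iff.2 hq)] at h1
    rw [norm_mul, norm_neg, Complex.norm_real, Real.norm_of_nonneg ht.le]
    linarith
  rw [rectCauchyInv, div_div_cancel₀ hz0]
  refine (rectU_mul_sub_one hlam hnorm).symm.trans ?_
  congr 1
  ring

/-! ### Infinite divisibility and the Lévy measure -/

lemma isRectConv_rectCauchy (hlam : lam ∈ Icc (0 : ℝ) 1) {s : ℝ} (hs : 0 < s) (ht : 0 < t) :
    IsRectConv lam (rectCauchy lam s) (rectCauchy lam t) (rectCauchy lam (s + t)) := by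
  refine ⟨isSymmProb_rectCauchy hlam hs, isSymmProb_rectCauchy hlam ht,
    isSymmProb_rectCauchy hlam (by positivity), _, _, isRectRTransform_rectCauchy hlam hs,
    isRectRTransform_rectCauchy hlam ht, ?_⟩
  convert isRectRTransform_rectCauchy hlam (add_pos hs ht) using 2
  push_cast
  ring

lemma isRectConvPow_rectCauchy (hlam : lam ∈ Icc (0 : ℝ) 1) (ht : 0 < t) (n : ℕ) :
    IsRectConvPow lam (rectCauchy lam t) (n + 1) (rectCauchy lam ((n + 1) * t)) := by
  induction n with
  | zero => simp [IsRectConvPow]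
  | succ n ih =>
    refine ⟨_, ih, ?_⟩
    convert isRectConv_rectCauchy hlam (show 0 < (n + 1 : ℝ) * t by positivity) ht using 2
    push_cast
    ring

lemma isRectInfDiv_rectCauchy (hlam : lam ∈ Icc (0 : ℝ) 1) (ht : 0 < t) :
    IsRectInfDiv lam (rectCauchy lam t) := by
  refine ⟨isSymmProb_rectCauchy hlam ht, fun n hn => ?_⟩
  obtain ⟨m, rfl⟩ : ∃ m, n = m + 1 := ⟨n - 1, by omega⟩
  have hm : 0 < t / (m + 1 : ℝ) := by positivity
  refine ⟨_, isSymmProb_rectCauchy hlam hm, ?_⟩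
  convert isRectConvPow_rectCauchy hlam hm m using 2
  field_simp

lemma levyTransform_cauchyLevy (ht : 0 < t) {z : ℂ} (hz : -z ∈ Complex.slitPlane) :
    z * ∫ x : ℝ, (1 + (x : ℂ) ^ 2) / (1 - z * (x : ℂ) ^ 2) ∂(cauchyLevy t) = -t * negSqrt z := by
  obtain ⟨hζ, hzζ⟩ := re_inv_negSqrt_pos_and_neg_inv_sq_eq hz
  have hq : negSqrt z ≠ 0 := ne_zero_of_re_pos (cpow_half_re_pos hz)
  have hpi' : (Real.pi : ℂ) ≠ 0 := by exact_mod_cast Real.pi_ne_zero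
  have hqζ : negSqrt z = 1 / (1 / negSqrt z) := by rw [one_div_one_div]
  set ζ := 1 / negSqrt z
  have hζ0 := ne_zero_of_re_pos hζ
  rw [cauchyLevy, integral_smul_measure, ENNReal.toReal_ofReal ht.le, integral_cauchyLaw one_pos]
  have e : ∀ x : ℝ, (1 / (Real.pi * (1 ^ 2 + x ^ 2))) •
      ((1 + (x : ℂ) ^ 2) / (1 - z * (x : ℂ) ^ 2)) =
      ζ ^ 2 / Real.pi * (1 / (ζ ^ 2 + (x : ℂ) ^ 2)) := by
    intro x
    have h1 : (1 : ℂ) + (x : ℂ) ^ 2 ≠ 0 := by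
      have : (0 : ℝ) < 1 + x ^ 2 := by positivity
      exact_mod_cast this.ne'
    have h2 := sq_add_sq_ne_zero hζ x
    have h3 : 1 - z * (x : ℂ) ^ 2 = (ζ ^ 2 + (x : ℂ) ^ 2) / ζ ^ 2 := by
      rw [← hzζ]; field_simp; ring
    rw [h3, Complex.real_smul]
    push_cast
    rw [one_pow]
    field_simp
  rw [integral_congr_ae (ae_of_all _ e), integral_const_mul, integral_complex_inv_sq_add_sq hζ,
    Complex.real_smul, hqζ, ← hzζ]
  field_simp

lemma isRectLevy_rectCauchy (hlam : lam ∈ Icc (0 : ℝ) 1) (ht : 0 < t) :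
    IsRectLevy lam (rectCauchy lam t) (cauchyLevy t) :=
  ⟨isSymmFinite_cauchyLevy t, (isRectRTransform_rectCauchy hlam ht).congr
    (nearZero_neg_mem_slitPlane.mono fun _ hz => levyTransform_cauchyLevy ht hz)⟩

lemma isRectBPImage_rectCauchy (hlam : lam ∈ Icc (0 : ℝ) 1) (ht : 0 < t) :
    IsRectBPImage lam (cauchyLaw t) (rectCauchy lam t) :=
  ⟨isSymmProb_cauchyLaw ht, isInfDiv_cauchyLaw ht, isRectInfDiv_rectCauchy hlam ht,
    cauchyLevy t, isClassicalLevy_cauchyLaw ht, isRectLevy_rectCauchy hlam ht⟩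

end

/-! ### A symmetric law is determined by its rectangular R-transform -/

section

variable {u : ℝ}

lemma norm_inv_add_sq_pow_le {a : ℝ} (ha : 0 < a) (hu : a ≤ u) (n : ℕ) (x : ℝ) :
    ‖(1 / (u + x ^ 2)) ^ n‖ ≤ (1 / a) ^ n := by
  have : 0 < u := ha.trans_le hu
  rw [Real.norm_of_nonneg (by positivity)]
  gcongr
  nlinarith [sq_nonneg x]

lemma integrable_inv_add_sq_pow (μ : Measure ℝ) [IsFiniteMeasure μ] (hu : 0 < u) (n : ℕ) :
    Integrable (fun x : ℝ => (1 / (u + x ^ 2)) ^ n) μ :=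
  Integrable.of_bound (C := (1 / u) ^ n) (Measurable.aestronglyMeasurable (by fun_prop))
    (ae_of_all _ (norm_inv_add_sq_pow_le hu le_rfl n))

lemma hasDerivAt_integral_inv_add_sq_pow (μ : Measure ℝ) [IsFiniteMeasure μ] (hu : 0 < u) (n : ℕ) :
    HasDerivAt (fun u => ∫ x : ℝ, (1 / (u + x ^ 2)) ^ (n + 1) ∂μ)
      (∫ x : ℝ, -(n + 1) * (1 / (u + x ^ 2)) ^ (n + 2) ∂μ) u := by
  refine (hasDerivAt_integral_of_dominated_loc_of_deriv_le
    (F' := fun u x => -(n + 1) * (1 / (u + x ^ 2)) ^ (n + 2)) (s := Ioi (u / 2))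
    (bound := fun _ => (n + 1) * (1 / (u / 2)) ^ (n + 2)) (Ioi_mem_nhds (by linarith))
    (Eventually.of_forall fun v => Measurable.aestronglyMeasurable (by fun_prop))
    (integrable_inv_add_sq_pow μ hu _) (Measurable.aestronglyMeasurable (by fun_prop))
    (ae_of_all _ fun x v hv => ?_) (integrable_const _) (ae_of_all _ fun x v hv => ?_)).2
  · rw [norm_mul, norm_neg, Real.norm_of_nonneg (by positivity : (0 : ℝ) ≤ n + 1)]
    gcongr
    exact norm_inv_add_sq_pow_le (by linarith) (le_of_lt hv) _ x
  · have hv0 : 0 < v := lt_trans (by linarith) (mem_Ioi.1 hv)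
    have h0 : v + x ^ 2 ≠ 0 := by positivity
    have h1 := (((hasDerivAt_id v).add_const (x ^ 2)).inv h0).pow (n + 1)
    simp only [one_div]
    refine h1.congr_deriv ?_
    simp only [id, Pi.inv_apply, Nat.add_sub_cancel]
    push_cast
    generalize v + x ^ 2 = w at h0
    rw [inv_pow, inv_pow]
    field_simp
    rw [pow_add]

/-- Equality of `∫ 1 / (u + x ^ 2)` for large `u` propagates to all powers by differentiation. -/
lemma integral_inv_add_sq_pow_eq {μ ν : Measure ℝ} [IsProbabilityMeasure μ]
    [IsProbabilityMeasure ν] {u₀ : ℝ} (hu₀ : 0 < u₀)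
    (h : ∀ u, u₀ < u → ∫ x : ℝ, 1 / (u + x ^ 2) ∂μ = ∫ x : ℝ, 1 / (u + x ^ 2) ∂ν) (n : ℕ) :
    ∀ u, u₀ < u →
      ∫ x : ℝ, (1 / (u + x ^ 2)) ^ n ∂μ = ∫ x : ℝ, (1 / (u + x ^ 2)) ^ n ∂ν := by
  rcases n with _ | n
  · simp
  induction n with
  | zero => simpa using h
  | succ n ih =>
    intro u hu
    have hpos : 0 < u := hu₀.trans hu
    have h1 := hasDerivAt_integral_inv_add_sq_pow μ hpos n
    have h2 := hasDerivAt_integral_inv_add_sq_pow ν hpos n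
    have h3 := h1.unique (h2.congr_of_eventuallyEq
      (by filter_upwards [Ioi_mem_nhds hu] with v hv using ih v hv))
    rw [integral_const_mul, integral_const_mul] at h3
    exact mul_left_cancel₀ (by have : (0 : ℝ) < n + 1 := by positivity
                               linarith) h3

/-- The complex moment generating function of a bounded variable is the exponential generating
function of its moments. -/
lemma hasSum_complexMGF {μ : Measure ℝ} [IsFiniteMeasure μ] {r : ℝ → ℝ} (hr : Measurable r)
    {B : ℝ} (hB : ∀ x, ‖r x‖ ≤ B) (z : ℂ) :
    HasSum (fun n : ℕ => z ^ n / n.factorial * ((∫ x, r x ^ n ∂μ : ℝ) : ℂ)) (complexMGF r μ z) := by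
  set F : ℕ → ℝ → ℂ := fun n x => z ^ n / n.factorial * ((r x ^ n : ℝ) : ℂ) with hF
  have hbound : ∀ n x, ‖F n x‖ ≤ (‖z‖ * B) ^ n / n.factorial := by
    intro n x
    simp only [hF]
    rw [norm_mul, norm_div, norm_pow, Complex.norm_real, norm_pow, Complex.norm_natCast, mul_pow,
      div_mul_eq_mul_div]
    gcongr
    exact hB x
  have hint : ∀ n, Integrable (F n) μ := fun n =>
    Integrable.of_bound (C := (‖z‖ * B) ^ n / n.factorial)
      (Measurable.aestronglyMeasurable (by fun_prop)) (ae_of_all _ (hbound n))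
  have hsum : Summable fun n => ∫ x, ‖F n x‖ ∂μ := by
    refine Summable.of_nonneg_of_le (fun n => integral_nonneg fun x => norm_nonneg _) (fun n => ?_)
      ((Real.summable_pow_div_factorial (‖z‖ * B)).mul_left (μ.real univ))
    refine (integral_mono (hint n).norm (integrable_const _) (hbound n)).trans ?_
    rw [integral_const, smul_eq_mul]
  have h := hasSum_integral_of_summable_integral_norm hint hsum
  have e1 : ∀ n, ∫ x, F n x ∂μ = z ^ n / n.factorial * ((∫ x, r x ^ n ∂μ : ℝ) : ℂ) := fun n => by
    simp only [hF]
    rw [integral_const_mul, integral_complex_ofReal]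
  have e2 : ∫ x, ∑' n, F n x ∂μ = complexMGF r μ z := by
    refine integral_congr_ae (ae_of_all _ fun x => ?_)
    simp only [hF]
    rw [Complex.exp_eq_exp_ℂ, NormedSpace.exp_eq_tsum_div]
    congr 1
    ext n
    push_cast
    rw [mul_pow]
    ring
  rw [e2] at h
  simpa only [e1] using h

/-- Two symmetric laws with the same Stieltjes transform of the square near infinity agree: the
bounded variable `1 / (u + x ^ 2)` has the same moments, hence the same law, under both. -/
lemma IsSymmProb.eq_of_integral_inv_eq {μ ν : Measure ℝ} (hμ : IsSymmProb μ) (hν : IsSymmProb ν)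
    {u₀ : ℝ} (hu₀ : 0 < u₀)
    (h : ∀ u, u₀ < u → ∫ x : ℝ, 1 / (u + x ^ 2) ∂μ = ∫ x : ℝ, 1 / (u + x ^ 2) ∂ν) : μ = ν := by
  have := hμ.isProb
  have := hν.isProb
  set u := u₀ + 1 with hu
  have hu0 : 0 < u := by positivity
  set r : ℝ → ℝ := fun x => 1 / (u + x ^ 2) with hr
  have hrm : Measurable r := by fun_prop
  have hB : ∀ x, ‖r x‖ ≤ 1 / u := fun x => by
    simpa only [pow_one] using norm_inv_add_sq_pow_le hu0 le_rfl 1 x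
  have hmap : μ.map r = ν.map r := by
    refine Measure.ext_of_complexMGF_eq hrm.aemeasurable hrm.aemeasurable (funext fun z => ?_)
    refine (hasSum_complexMGF hrm hB z).unique ?_
    have hmom := fun n => integral_inv_add_sq_pow_eq hu₀ h n u (by linarith)
    simp only [hr, hmom]
    exact hasSum_complexMGF hrm hB z
  refine Measure.ext_of_charFun (funext fun ξ => ?_)
  -- `cos (x ξ)` is a function of `1 / (u + x ^ 2)`
  set g : ℝ → ℝ := fun v => Real.cos (√(1 / v - u) * ξ) with hg
  have hgm : Measurable g := by fun_prop
  have hgr : ∀ x, Real.cos (x * ξ) = g (r x) := by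
    intro x
    simp only [hg, hr]
    rw [one_div_one_div, add_sub_cancel_left, Real.sqrt_sq_eq_abs]
    rcases abs_choice x with h | h <;> simp [h]
  rw [charFun_of_symm hμ.symm, charFun_of_symm hν.symm]
  congr 1
  simp only [hgr]
  rw [← integral_map hrm.aemeasurable hgm.aestronglyMeasurable, hmap,
    integral_map hrm.aemeasurable hgm.aestronglyMeasurable]

end

section

variable {lam : ℝ}

lemma rectU_injective (lam : ℝ) : Function.Injective (rectU lam) := by
  intro a b hab
  unfold rectU at hab
  split_ifs at hab with h
  · exact hab
  have hl : (lam : ℂ) ≠ 0 := by exact_mod_cast h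
  rw [div_left_inj' (by simpa using hl), add_right_inj] at hab
  have h2 := congrArg (· ^ 2) hab
  simp only [cpow_half_sq, add_right_inj] at h2
  exact mul_left_cancel₀ (by simpa using hl) h2

lemma integral_inv_add_sq_pos {μ : Measure ℝ} [IsProbabilityMeasure μ] {u : ℝ} (hu : 0 < u) :
    0 < ∫ x : ℝ, 1 / (u + x ^ 2) ∂μ := by
  have hi : Integrable (fun x : ℝ => 1 / (u + x ^ 2)) μ := by
    simpa using integrable_inv_add_sq_pow μ hu 1
  refine (integral_pos_iff_support_of_nonneg (fun x => by positivity) hi).2 ?_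
  have : Function.support (fun x : ℝ => 1 / (u + x ^ 2)) = univ := by
    ext x
    simp only [Function.mem_support, mem_univ, iff_true]
    positivity
  rw [this, measure_univ]
  exact one_pos

lemma integral_inv_add_sq_le {μ : Measure ℝ} [IsProbabilityMeasure μ] {u : ℝ} (hu : 0 < u) :
    ∫ x : ℝ, 1 / (u + x ^ 2) ∂μ ≤ 1 / u := by
  have hi : Integrable (fun x : ℝ => 1 / (u + x ^ 2)) μ := by
    simpa using integrable_inv_add_sq_pow μ hu 1
  calc _ ≤ ∫ _, 1 / u ∂μ := by
        refine integral_mono hi (integrable_const _) fun x => ?_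
        have := norm_inv_add_sq_pow_le hu le_rfl 1 x
        rw [pow_one, pow_one, Real.norm_of_nonneg (by positivity)] at this
        exact this
    _ = 1 / u := by simp

/-- On the negative half-line `H` takes real values. -/
lemma rectH_neg_real {μ : Measure ℝ} (hμ : IsSymmProb μ) {r : ℝ} (hr : 0 < r) :
    rectH lam μ (-(1 / (r : ℂ)) ^ 2) =
      -((lam * r ^ 2 * (∫ x : ℝ, 1 / (r ^ 2 + x ^ 2) ∂μ) ^ 2 +
        (1 - lam) * ∫ x : ℝ, 1 / (r ^ 2 + x ^ 2) ∂μ : ℝ) : ℂ) := by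
  rw [rectH_neg_inv_sq lam hμ (by simpa)]
  have : ∫ x : ℝ, 1 / ((r : ℂ) ^ 2 + (x : ℂ) ^ 2) ∂μ =
      ((∫ x : ℝ, 1 / (r ^ 2 + x ^ 2) ∂μ : ℝ) : ℂ) := by
    rw [← integral_complex_ofReal]; push_cast; rfl
  rw [this]
  push_cast
  ring

lemma neg_ofReal_mem_sector {h α β : ℝ} (hα : 0 < α) (h0 : 0 < h) (hβ : h < β) :
    -(h : ℂ) ∈ sector α β := by
  refine ⟨by simpa using h0.ne', ?_, ?_⟩
  · rw [neg_neg, Complex.arg_ofReal_of_nonneg h0.le]; simpa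
  · rw [norm_neg, Complex.norm_real, Real.norm_of_nonneg h0.le]; exact hβ

/-- A symmetric law is determined by its rectangular R-transform: the R-transform determines the
compositional inverse of `H`, hence `H` on the negative half-line near zero, hence the Stieltjes
transform of the square near infinity. -/
theorem IsRectRTransform.unique (hlam : lam ∈ Icc (0 : ℝ) 1) {μ ν : Measure ℝ} (hμ : IsSymmProb μ)
    (hν : IsSymmProb ν) {C : ℂ → ℂ} (hC : IsRectRTransform lam μ C)
    (hC' : IsRectRTransform lam ν C) : μ = ν := by
  have := hμ.isProb
  have := hν.isProb
  obtain ⟨F, hF, hFC⟩ := hC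
  obtain ⟨F', hF', hFC'⟩ := hC'
  have hFF : NearZero fun z => F z = F' z := by
    refine (hFC.and hFC').mono_of_ne_zero fun z hz0 ⟨h1, h2⟩ => ?_
    have h3 := rectU_injective lam (h1.symm.trans h2)
    -- inversion is injective also at `0`, so vanishing of `F z` need not be excluded
    rw [sub_left_inj, div_eq_mul_inv, div_eq_mul_inv] at h3
    exact inv_injective (mul_left_cancel₀ hz0 h3)
  have hpi2 : Real.pi / 2 ∈ Ioo 0 Real.pi := ⟨by positivity, by linarith [Real.pi_pos]⟩
  obtain ⟨β, hβ, H⟩ := ((hFF.and hF.right_inv).and hF'.left_inv) _ hpi2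
  refine hμ.eq_of_integral_inv_eq hν (u₀ := 1 / β) (by positivity) fun u hu => ?_
  have hu0 : 0 < u := lt_trans (by positivity) hu
  have huβ : 1 / u < β := by rwa [one_div_lt hu0 hβ]
  obtain ⟨r, hr, rfl⟩ : ∃ r : ℝ, 0 < r ∧ r ^ 2 = u := ⟨√u, Real.sqrt_pos.2 hu0, Real.sq_sqrt hu0.le⟩
  have hm := integral_inv_add_sq_pos (μ := μ) hu0
  have hn := integral_inv_add_sq_pos (μ := ν) hu0
  have hn' := integral_inv_add_sq_le (μ := ν) hu0
  have eμ := rectH_neg_real (lam := lam) hμ hr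
  have eν := rectH_neg_real (lam := lam) hν hr
  set m := ∫ x : ℝ, 1 / (r ^ 2 + x ^ 2) ∂μ
  set n := ∫ x : ℝ, 1 / (r ^ 2 + x ^ 2) ∂ν
  have hl0 := hlam.1
  have hl1 : 0 ≤ 1 - lam := by linarith [hlam.2]
  -- `lam` and `1 - lam` do not vanish simultaneously
  have hpos : ∀ a > 0, 0 < lam * r ^ 2 * a + (1 - lam) := by
    intro a ha
    rcases hl0.eq_or_lt with h | h
    · rw [← h]; simp
    · have : 0 < lam * r ^ 2 * a := by positivity
      linarith
  have hw0 : 0 < lam * r ^ 2 * n ^ 2 + (1 - lam) * n := by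
    have := mul_pos (hpos n hn) hn
    nlinarith
  have hrn : r ^ 2 * n ≤ 1 := by
    rw [le_div_iff₀ hu0] at hn'; linarith
  have hw1 : lam * r ^ 2 * n ^ 2 + (1 - lam) * n ≤ n := by
    have : 0 ≤ lam * n * (1 - r ^ 2 * n) := by
      have := sub_nonneg.2 hrn
      positivity
    nlinarith
  have hz : -(1 / (r : ℂ)) ^ 2 ∈ sector (Real.pi / 2) β := by
    have := neg_ofReal_mem_sector hpi2.1 (show 0 < 1 / r ^ 2 by positivity) huβ
    convert this using 2
    push_cast
    rw [one_div_pow]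
  -- the value of `H` for `ν` stays in the sector, so the two inverses agree there
  have hw := neg_ofReal_mem_sector hpi2.1 hw0 ((hw1.trans hn').trans_lt huβ)
  have hFw := (H _ hz).2
  rw [eν] at hFw
  obtain ⟨⟨h1, h2⟩, -⟩ := H _ hw
  rw [h1, hFw, eμ, neg_inj, Complex.ofReal_inj] at h2
  have h3 : (m - n) * (lam * r ^ 2 * (m + n) + (1 - lam)) = 0 := by linear_combination h2
  rcases mul_eq_zero.1 h3 with h | h
  · linarith
  · exact absurd h (hpos _ (by positivity)).ne'

end

/-! ### The image of the Cauchy law, its support, and the Cauchy case -/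

section

variable {lam t : ℝ}

lemma rectBP_cauchyLaw (hlam : lam ∈ Icc (0 : ℝ) 1) (ht : 0 < t) :
    rectBP lam (cauchyLaw t) = rectCauchy lam t := by
  have huniq : ∀ ν, IsRectBPImage lam (cauchyLaw t) ν → ν = rectCauchy lam t := by
    rintro ν ⟨-, -, hν, G, hG, hGν⟩
    rw [hG.unique (isClassicalLevy_cauchyLaw ht)] at hGν
    exact IsRectRTransform.unique hlam hν.1 (isSymmProb_rectCauchy hlam ht) hGν.2
      (isRectLevy_rectCauchy hlam ht).2
  have h : ∃! ν, IsRectBPImage lam (cauchyLaw t) ν :=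
    ⟨_, isRectBPImage_rectCauchy hlam ht, huniq⟩
  rw [rectBP, dif_pos h]
  exact huniq _ h.choose_spec.1

lemma rectCauchyDensity_eq_zero {x : ℝ}
    (hx : x ∈ Icc (-(t * (1 - lam) / 2)) (t * (1 - lam) / 2)) :
    rectCauchyDensity lam t x = 0 :=
  indicator_of_notMem (not_not.2 hx) _

lemma rectCauchyDensity_pos (hlam : lam ∈ Icc (0 : ℝ) 1) (ht : 0 < t) {x : ℝ}
    (hx : x ∉ Icc (-(t * (1 - lam) / 2)) (t * (1 - lam) / 2)) :
    0 < rectCauchyDensity lam t x := by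
  have hl0 := hlam.1
  have hl1 : 0 ≤ 1 - lam := by linarith [hlam.2]
  have hc : 0 ≤ t * (1 - lam) / 2 := by positivity
  have habs : t * (1 - lam) / 2 < |x| := by
    by_contra! h
    exact hx (abs_le.1 h)
  have hx2 : (t * (1 - lam) / 2) ^ 2 < x ^ 2 := by
    rw [← sq_abs x]; exact pow_lt_pow_left₀ habs hc two_ne_zero
  have hx0 : 0 < x ^ 2 := lt_of_le_of_lt (sq_nonneg _) hx2
  have hpi := Real.pi_pos
  rw [rectCauchyDensity, indicator_of_mem (by exact hx)]
  refine mul_pos (by positivity) (Real.sqrt_pos.2 ?_)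
  rw [sub_pos, div_lt_one (by positivity)]
  nlinarith

lemma rectCauchy_Ioo (lam t : ℝ) :
    rectCauchy lam t (Ioo (-(t * (1 - lam) / 2)) (t * (1 - lam) / 2)) = 0 := by
  rw [rectCauchy, withDensity_apply _ measurableSet_Ioo]
  refine (setLIntegral_congr_fun measurableSet_Ioo fun x hx => ?_).trans lintegral_zero
  simp only [rectCauchyDensity_eq_zero (Ioo_subset_Icc_self hx), ENNReal.ofReal_zero]

lemma rectCauchy_pos_of_isOpen (hlam : lam ∈ Icc (0 : ℝ) 1) (ht : 0 < t) {U : Set ℝ}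
    (hU : IsOpen U) {x : ℝ} (hxU : x ∈ U)
    (hx : x ∉ Icc (-(t * (1 - lam) / 2)) (t * (1 - lam) / 2)) :
    0 < rectCauchy lam t U := by
  have hV : IsOpen (U ∩ (Icc (-(t * (1 - lam) / 2)) (t * (1 - lam) / 2))ᶜ) :=
    hU.inter isClosed_Icc.isOpen_compl
  have hvol := hV.measure_pos volume ⟨x, hxU, hx⟩
  rw [pos_iff_ne_zero] at hvol ⊢
  intro h0
  apply hvol
  rw [rectCauchy, withDensity_apply_eq_zero
    measurable_rectCauchyDensity.ennreal_ofReal] at h0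
  refine measure_mono_null (fun y hy => ?_) h0
  refine ⟨?_, hy.1⟩
  simpa using rectCauchyDensity_pos hlam ht hy.2

lemma support_rectCauchy (hlam : lam ∈ Icc (0 : ℝ) 1) (ht : 0 < t) :
    (rectCauchy lam t).support = (Ioo (-(t * (1 - lam) / 2)) (t * (1 - lam) / 2))ᶜ := by
  have hl1 : 0 ≤ 1 - lam := by linarith [hlam.2]
  have hc : 0 ≤ t * (1 - lam) / 2 := by positivity
  set c := t * (1 - lam) / 2 with hcdef
  refine Subset.antisymm ?_ fun x hx => ?_
  · rw [subset_compl_comm]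
    exact Measure.subset_compl_support_of_isOpen isOpen_Ioo (rectCauchy_Ioo lam t)
  · -- points outside `[-c, c]` are in the support, which is closed
    have hsub : (Icc (-c) c)ᶜ ⊆ (rectCauchy lam t).support := by
      intro y hy
      rw [Measure.mem_support_iff_forall]
      intro U hU
      obtain ⟨V, hVU, hV, hyV⟩ := mem_nhds_iff.1 hU
      exact (rectCauchy_pos_of_isOpen hlam ht hV hyV hy).trans_le (measure_mono hVU)
    have hcl := closure_minimal hsub Measure.isClosed_support
    refine hcl ?_
    have hx' : x ≤ -c ∨ c ≤ x := by
      by_contra! h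
      exact hx h
    have h1 : closure (Iio (-c)) ⊆ closure (Icc (-c) c)ᶜ :=
      closure_mono fun y hy h => not_lt.2 h.1 hy
    have h2 : closure (Ioi c) ⊆ closure (Icc (-c) c)ᶜ :=
      closure_mono fun y hy h => not_lt.2 h.2 hy
    rw [closure_Iio] at h1
    rw [closure_Ioi] at h2
    exact hx'.elim (fun h => h1 h) (fun h => h2 h)

lemma rectCauchy_one (ht : 0 < t) : rectCauchy 1 t = cauchyLaw t := by
  rw [rectCauchy, cauchyLaw_eq_withDensity ht]
  refine withDensity_congr_ae ?_
  filter_upwards [compl_mem_ae_iff.2 (measure_singleton (0 : ℝ))] with x hx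
  have hx' : x ≠ 0 := by simpa using hx
  rw [rectCauchyDensity, indicator_of_mem]
  · simp
  · simpa using hx'

lemma cauchyMeasure_pos_of_isOpen (x₀ : ℝ) {s : ℝ} (hs : 0 < s) {U : Set ℝ} (hU : IsOpen U)
    (hne : U.Nonempty) : 0 < cauchyMeasure x₀ s.toNNReal U := by
  have hs' : s.toNNReal ≠ 0 := by simpa using hs
  have hvol := hU.measure_pos volume hne
  rw [pos_iff_ne_zero] at hvol ⊢
  intro h0
  apply hvol
  rw [cauchyMeasure_of_scale_ne_zero _ hs', withDensity_apply_eq_zero (by fun_prop)] at h0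
  refine measure_mono_null (fun y hy => ?_) h0
  refine ⟨?_, hy⟩
  simpa [cauchyPDF] using cauchyPDF_pos x₀ hs' y

/-- A Cauchy law charges every open interval, so the gap `(-c, c)` must be empty. -/
lemma rectCauchy_eq_cauchyMeasure_iff (hlam : lam ∈ Icc (0 : ℝ) 1) (ht : 0 < t) :
    (∃ x₀ s : ℝ, 0 < s ∧ rectCauchy lam t = cauchyMeasure x₀ s.toNNReal) ↔ lam = 1 := by
  constructor
  · rintro ⟨x₀, s, hs, h⟩
    by_contra hne
    have hl1 : 0 < 1 - lam := sub_pos.2 (lt_of_le_of_ne hlam.2 hne)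
    have hc : 0 < t * (1 - lam) / 2 := by positivity
    have := cauchyMeasure_pos_of_isOpen x₀ hs isOpen_Ioo
      (nonempty_Ioo.2 (show -(t * (1 - lam) / 2) < t * (1 - lam) / 2 by linarith))
    rw [← h, rectCauchy_Ioo] at this
    exact lt_irrefl _ this
  · rintro rfl
    exact ⟨0, t, ht, rectCauchy_one ht⟩

end

end RectFree

end

theorem mainTheorem7 (lam : ℝ) (hlam : lam ∈ Set.Icc (0 : ℝ) 1) (t : ℝ) (ht : 0 < t) :
    RectFree.IsRectBPImage lam (RectFree.cauchyLaw t)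
        (RectFree.rectBP lam (RectFree.cauchyLaw t)) ∧
      RectFree.rectBP lam (RectFree.cauchyLaw t) =
        (MeasureTheory.volume : MeasureTheory.Measure ℝ).withDensity
          (fun x => ENNReal.ofReal (RectFree.rectCauchyDensity lam t x)) ∧
      (RectFree.rectBP lam (RectFree.cauchyLaw t)).support =
        (Set.Ioo (-(t * (1 - lam) / 2)) (t * (1 - lam) / 2))ᶜ ∧
      ((∃ (x₀ s : ℝ), 0 < s ∧ RectFree.rectBP lam (RectFree.cauchyLaw t) =
          ProbabilityTheory.cauchyMeasure x₀ s.toNNReal) ↔ lam = 1) := by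
  rw [RectFree.rectBP_cauchyLaw hlam ht]
  exact ⟨RectFree.isRectBPImage_rectCauchy hlam ht, rfl, RectFree.support_rectCauchy hlam ht,
    RectFree.rectCauchy_eq_cauchyMeasure_iff hlam ht⟩
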